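/- Let $n\ge 1$ (for $T^{[1^n]}_{[n-1,1]}(SU(n))$, $n\ge 2$). Consider the vertex superalgebra $V$ over $\mathbb{C}$, realised on its Fock space, that is generated by symplectic bosons $X_i,Y_i$ (even, $1\le i\le n$), fermi multiplets $\psi_i,\chi_i$ (odd, $1\le i\le n$) and ghosts $b_a,c^a$ (odd, $1\le a\le n-1$), whose only singular operator products are $$X_i(z)Y_j(0)\sim\frac{\delta_{ij}}{z},\qquad \psi_i(z)\chi_j(0)\sim\frac{\delta_{ij}}{z},\qquad b_a(z)c^{b}(0)\sim\frac{\delta_a^{b}}{z}$$ (and those with the two factors exchanged). For fields $A,B$ let $AB$ be the normally ordered product $(AB)_0(w)=\oint\frac{dz}{2\pi i}\frac{A(z)B(w)}{z-w}$, with longer products nested to the right, $ABC=A(BC)$, and let $[A,B]:=AB-BA$ be the commutator for this product (also when $A$, $B$ are odd). Put $$J_{BRST}=\sum_{a=1}^{n-1}c^a\left(X_aY_a-X_{a+1}Y_{a+1}+\psi_a\chi_a-\psi_{a+1}\chi_{a+1}\right),\qquad Q=\oint\frac{dz}{2\pi i}J_{BRST}(z),$$ and write $A\equiv B$ if $A-B=QC$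 for some $C\in V$. Define $$\mathcal A_i=-X_iY_i,\qquad \hat{\mathcal A}_i\mathcal O=\mathcal A_i\mathcal O,\qquad \mathcal D_i\mathcal O=\mathcal A_i\mathcal O+X_i(Y_i\mathcal O),$$ $$T_i=\tfrac12(\mathcal D_i+\hat{\mathcal A}_i)\mathcal A_i,\qquad W_i=\tfrac13\sqrt{\tfrac23}\left\{\mathcal D_i(\mathcal D_i\mathcal A_i)+\tfrac12\mathcal D_i(\hat{\mathcal A}_i\mathcal A_i)+\tfrac12\hat{\mathcal A}_i(\mathcal D_i\mathcal A_i)+\hat{\mathcal A}_i(\hat{\mathcal A}_i\mathcal A_i)\right\},$$ $$U=-\frac1n\sum_{i=1}^nX_iY_i,\qquad U_F=-\frac1n\sum_{i=1}^n\psi_i\chi_i,\qquad M_i^+=X_i\psi_i,\qquad M_i^-=Y_i\chi_i.$$ Then for every $i\in\{1,\dots,n\}$: 1. $$W_i\equiv\tfrac13\sqrt{\tfrac23}\left\{\tfrac32\left(M_i^+\partial M_i^-+M_i^-\partial M_i^+\right)-\tfrac32(U+U_F)[M_i^+,M_i^-]+(U+U_F)^3+\partial^2(U+U_F)\right\};$$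 2. $$T_i\equiv\tfrac12(U+U_F)^2-\tfrac12[M_i^+,M_i^-];$$ 3. the pair $(T_i,W_i)$ is generated, in the BRST cohomology, by $U+U_F$ and $M_i^\pm$: every element of the vertex subalgebra generated by $T_i$ and $W_i$ is $Q$-closed and is $\equiv$ to a $Q$-closed element of the vertex subalgebra generated by $U+U_F$, $M_i^+$ and $M_i^-$. -/

import Mathlib

open scoped TensorProduct

noncomputable section

namespace BoundaryVOA

/-! ### The Fock space

Creation modes `X_{i,(-k-1)}`, `Y_{i,(-k-1)}` are the polynomial variables indexed by
`(X i, k)`, `(Y i, k)`; creation modes of the anticommuting fields `ψ_i`, `χ_i`, `b_a`, `c^a` are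
the exterior generators indexed in the same way. -/

/-- The symplectic bosons `X_i`, `Y_i`, for `i = 1, …, n`. -/
inductive Boson (n : ℕ) : Type
  | X (i : Fin n)
  | Y (i : Fin n)

/-- The fermi multiplets `ψ_i`, `χ_i`, for `i = 1, …, n`, and the ghosts `b_a`, `c^a`, for
`a = 1, …, n - 1`. -/
inductive Fermion (n : ℕ) : Type
  | psi (i : Fin n)
  | chi (i : Fin n)
  | b (a : Fin (n - 1))
  | c (a : Fin (n - 1))

/-- Bosonic Fock space. -/
abbrev BosonFock (n : ℕ) : Type := MvPolynomial (Boson n × ℕ) ℂ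

/-- Fermionic Fock space. -/
abbrev FermionFock (n : ℕ) : Type := ExteriorAlgebra ℂ ((Fermion n × ℕ) →₀ ℂ)

/-- The state space of the symplectic bosons, the fermi multiplets and the ghosts. -/
def Fock (n : ℕ) : Type := BosonFock n ⊗[ℂ] FermionFock n

instance (n : ℕ) : AddCommGroup (Fock n) :=
  inferInstanceAs (AddCommGroup (BosonFock n ⊗[ℂ] FermionFock n))

instance (n : ℕ) : Module ℂ (Fock n) :=
  inferInstanceAs (Module ℂ (BosonFock n ⊗[ℂ] FermionFock n))

variable {n : ℕ}

/-- The identification of the tensor product with the state space. -/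
def fockEquiv : (BosonFock n ⊗[ℂ] FermionFock n) ≃ₗ[ℂ] Fock n := LinearEquiv.refl ℂ _

/-- The parity involution `(-1)^F` of the Fock space. -/
def parity : Module.End ℂ (Fock n) :=
  fockEquiv.conj (LinearMap.lTensor (BosonFock n)
    (CliffordAlgebra.involute : FermionFock n →ₐ[ℂ] FermionFock n).toLinearMap)

/-- Multiplication by a bosonic variable. -/
def createB (s : Boson n) (k : ℕ) : Module.End ℂ (Fock n) :=
  fockEquiv.conj (LinearMap.rTensor (FermionFock n)
    (LinearMap.mulLeft ℂ (MvPolynomial.X (s, k) : BosonFock n)))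

/-- Differentiation with respect to a bosonic variable. -/
def removeB (s : Boson n) (k : ℕ) : Module.End ℂ (Fock n) :=
  fockEquiv.conj (LinearMap.rTensor (FermionFock n)
    (MvPolynomial.pderiv (s, k) : Derivation ℂ (BosonFock n) (BosonFock n)).toLinearMap)

/-- Left multiplication by a fermionic generator. -/
def createF (s : Fermion n) (k : ℕ) : Module.End ℂ (Fock n) :=
  fockEquiv.conj (LinearMap.lTensor (BosonFock n)
    (LinearMap.mulLeft ℂ (ExteriorAlgebra.ι ℂ (Finsupp.single (s, k) (1 : ℂ)))))

/-- Contraction with the dual of a fermionic generator. -/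
def removeF (s : Fermion n) (k : ℕ) : Module.End ℂ (Fock n) :=
  fockEquiv.conj (LinearMap.lTensor (BosonFock n)
    (CliffordAlgebra.contractLeft (Q := (0 : QuadraticForm ℂ ((Fermion n × ℕ) →₀ ℂ)))
      (Finsupp.lapply (s, k))))

/-- It suffices to check annihilation on pure tensors. -/
theorem eventually_of_tmul (f : ℕ → Module.End ℂ (Fock n))
    (h : ∀ (p : BosonFock n) (w : FermionFock n), ∃ N, ∀ k ≥ N, f k (fockEquiv (p ⊗ₜ w)) = 0)
    (v : Fock n) : ∃ N, ∀ k ≥ N, f k v = 0 := by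
  obtain ⟨t, rfl⟩ := fockEquiv.surjective v
  induction t using TensorProduct.induction_on with
  | zero => exact ⟨0, fun k _ => by rw [map_zero, map_zero]⟩
  | tmul p w => exact h p w
  | add x y hx hy =>
    obtain ⟨N, hN⟩ := hx
    obtain ⟨M, hM⟩ := hy
    refine ⟨max N M, fun k hk => ?_⟩
    rw [map_add, map_add, hN k (le_trans (le_max_left _ _) hk),
      hM k (le_trans (le_max_right _ _) hk), add_zero]

theorem removeB_eventually (s : Boson n) (v : Fock n) : ∃ N, ∀ k ≥ N, removeB s k v = 0 := by
  classical
  refine eventually_of_tmul (removeB s) (fun p w => ?_) v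
  refine ⟨(p.vars.image Prod.snd).sup id + 1, fun k hk => ?_⟩
  have hnot : (s, k) ∉ p.vars := by
    intro hmem
    have h1 : k ≤ (p.vars.image Prod.snd).sup id :=
      Finset.le_sup (f := id) (Finset.mem_image_of_mem Prod.snd hmem)
    omega
  have h2 : MvPolynomial.pderiv (s, k) p = 0 :=
    MvPolynomial.pderiv_eq_zero_of_notMem_vars hnot
  simp [removeB, LinearEquiv.conj_apply, h2]

theorem removeF_eventually (s : Fermion n) (v : Fock n) : ∃ N, ∀ k ≥ N, removeF s k v = 0 := by
  classical
  have key : ∀ w : FermionFock n, ∃ N, ∀ k ≥ N,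
      CliffordAlgebra.contractLeft (Q := (0 : QuadraticForm ℂ ((Fermion n × ℕ) →₀ ℂ)))
        (Finsupp.lapply (s, k)) w = 0 := by
    intro w
    induction w using CliffordAlgebra.left_induction with
    | algebraMap r => exact ⟨0, fun k _ => by
        rw [CliffordAlgebra.contractLeft_algebraMap]⟩
    | add x y hx hy =>
      obtain ⟨N, hN⟩ := hx
      obtain ⟨M, hM⟩ := hy
      refine ⟨max N M, fun k hk => ?_⟩
      rw [map_add, hN k (le_trans (le_max_left _ _) hk), hM k (le_trans (le_max_right _ _) hk),
        add_zero]
    | ι_mul x m hx =>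
      obtain ⟨N, hN⟩ := hx
      refine ⟨max N ((m.support.image Prod.snd).sup id + 1), fun k hk => ?_⟩
      have hm : m (s, k) = 0 := by
        by_contra hne
        have hmem : (s, k) ∈ m.support := Finsupp.mem_support_iff.2 hne
        have h1 : k ≤ (m.support.image Prod.snd).sup id :=
          Finset.le_sup (f := id) (Finset.mem_image_of_mem Prod.snd hmem)
        have h2 := le_trans (le_max_right N _) hk
        omega
      rw [CliffordAlgebra.contractLeft_ι_mul, hN k (le_trans (le_max_left _ _) hk)]
      simp [hm]
  refine eventually_of_tmul (removeF s) (fun p w => ?_) v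
  obtain ⟨N, hN⟩ := key w
  refine ⟨N, fun k hk => ?_⟩
  simp [removeF, LinearEquiv.conj_apply, hN k hk]

/-! ### Fields -/

/-- Fields `A(z) = ∑_m A_{(m)} z^{-m-1}` on the Fock space; `A_{(m)}` is
`VertexOperator.ncoeff A m`. -/
abbrev FockField (n : ℕ) : Type := VertexOperator ℂ (Fock n)

/-- The field with prescribed modes `A_{(m)}`. -/
def ofModes (f : ℤ → Module.End ℂ (Fock n)) (hf : ∀ v, ∃ N : ℤ, ∀ m ≥ N, f m v = 0) :
    FockField n :=
  VertexOperator.of_coeff (fun k => f (-k - 1)) (by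
    intro v
    obtain ⟨N, hN⟩ := hf v
    refine ⟨-N, fun k hk => ?_⟩
    by_contra hlt
    exact hk (hN _ (by omega)))

theorem ncoeff_ofModes (f : ℤ → Module.End ℂ (Fock n))
    (hf : ∀ v, ∃ N : ℤ, ∀ m ≥ N, f m v = 0) (m : ℤ) :
    VertexOperator.ncoeff (ofModes f hf) m = f m := by
  rw [ofModes, VertexOperator.ncoeff_of_coeff]
  congr 1
  ring

theorem ncoeff_eventually (A : FockField n) (v : Fock n) :
    ∃ N : ℤ, ∀ m ≥ N, VertexOperator.ncoeff A m v = 0 := by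
  refine ⟨-HahnSeries.order ((HahnModule.of ℂ).symm (A v)), fun m hm => ?_⟩
  exact VertexOperator.ncoeff_eq_zero_of_lt_order A m v (by omega)

/-- The identity field. -/
def one : FockField n :=
  ofModes (fun m => if m = -1 then 1 else 0) (fun v => ⟨0, fun m hm => by
    rw [if_neg (by omega), LinearMap.zero_apply]⟩)

/-- The modes of a free field: `create k` in degree `-k-1` and `remove k` in degree `k`. -/
def freeMode (create remove : ℕ → Module.End ℂ (Fock n)) : ℤ → Module.End ℂ (Fock n)
  | Int.ofNat k => remove k
  | Int.negSucc k => create k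

theorem freeMode_eventually (create remove : ℕ → Module.End ℂ (Fock n))
    (h : ∀ v, ∃ N, ∀ k ≥ N, remove k v = 0) (v : Fock n) :
    ∃ N : ℤ, ∀ m ≥ N, freeMode create remove m v = 0 := by
  obtain ⟨N, hN⟩ := h v
  refine ⟨N, fun m hm => ?_⟩
  obtain ⟨k, rfl⟩ := Int.eq_ofNat_of_zero_le (le_trans (Int.natCast_nonneg N) hm)
  exact hN k (by exact_mod_cast hm)

/-- `X_i(z)`, with `X_i(z) Y_j(0) ∼ δ_{ij} / z`. -/
def X (i : Fin n) : FockField n :=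
  ofModes (freeMode (createB (.X i)) (removeB (.Y i)))
    (freeMode_eventually _ _ (removeB_eventually _))

/-- `Y_i(z)`; since `X_i`, `Y_i` are bosonic, `Y_i(z) X_j(0) ∼ -δ_{ij} / z`. -/
def Y (i : Fin n) : FockField n :=
  ofModes (freeMode (createB (.Y i)) (fun k => -removeB (.X i) k))
    (freeMode_eventually _ _ (fun v => by
      obtain ⟨N, hN⟩ := removeB_eventually (.X i) v
      exact ⟨N, fun k hk => by rw [LinearMap.neg_apply, hN k hk, neg_zero]⟩))

/-- `ψ_i(z)`, with `ψ_i(z) χ_j(0) ∼ δ_{ij} / z`. -/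
def psi (i : Fin n) : FockField n :=
  ofModes (freeMode (createF (.psi i)) (removeF (.chi i)))
    (freeMode_eventually _ _ (removeF_eventually _))

/-- `χ_i(z)`. -/
def chi (i : Fin n) : FockField n :=
  ofModes (freeMode (createF (.chi i)) (removeF (.psi i)))
    (freeMode_eventually _ _ (removeF_eventually _))

/-- The ghost `b_a(z)`, with `b_a(z) c^b(0) ∼ δ_a^b / z`. -/
def b (a : Fin (n - 1)) : FockField n :=
  ofModes (freeMode (createF (.b a)) (removeF (.c a)))
    (freeMode_eventually _ _ (removeF_eventually _))

/-- The ghost `c^a(z)`. -/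
def c (a : Fin (n - 1)) : FockField n :=
  ofModes (freeMode (createF (.c a)) (removeF (.b a)))
    (freeMode_eventually _ _ (removeF_eventually _))

/-- The derivative `∂A(z)`, with modes `(∂A)_{(m)} = -m A_{(m-1)}`. -/
def der (A : FockField n) : FockField n :=
  ofModes (fun m => (-(m : ℂ)) • VertexOperator.ncoeff A (m - 1)) (fun v => by
    obtain ⟨N, hN⟩ := ncoeff_eventually A v
    refine ⟨N + 1, fun m hm => ?_⟩
    rw [LinearMap.smul_apply, hN (m - 1) (by omega), smul_zero])

/-! ### Products of fields -/

/-- The bilinear operation that equals `(-1)^{|x||y|} y x` when `x` and `y` are homogeneous: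
it is `y x₀ + (γ y γ) x₁`, where `γ` is the parity involution and `x₀ = (x + γ x γ) / 2`,
`x₁ = (x - γ x γ) / 2` are the even and the odd part of `x`. -/
def signedSwap (x y : Module.End ℂ (Fock n)) : Module.End ℂ (Fock n) :=
  y * ((1 / 2 : ℂ) • (x + parity * x * parity)) +
    (parity * y * parity) * ((1 / 2 : ℂ) • (x - parity * x * parity))

/-- The `j`-th term of the mode `(A_{(p)} B)_{(m)}`. -/
def prodTerm (A : FockField n) (p : ℤ) (B : FockField n) (m : ℤ) (j : ℕ) :
    Module.End ℂ (Fock n) :=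
  ((-1 : ℂ) ^ j * ((Ring.choose p j : ℤ) : ℂ)) •
    (VertexOperator.ncoeff A (p - j) * VertexOperator.ncoeff B (m + j) -
      (-1 : ℂ) ^ p •
        signedSwap (VertexOperator.ncoeff A j) (VertexOperator.ncoeff B (p + m - j)))

theorem prodTerm_bound (A : FockField n) (p : ℤ) (B : FockField n) (v : Fock n) :
    ∃ (J : ℕ) (M : ℤ), (∀ m, ∀ j : ℕ, J ≤ j → M ≤ m + j → prodTerm A p B m j v = 0) ∧
      (∀ m ≥ M, ∀ j, prodTerm A p B m j v = 0) := by
  obtain ⟨N₁, h₁⟩ := ncoeff_eventually A v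
  obtain ⟨N₂, h₂⟩ := ncoeff_eventually A (parity v)
  obtain ⟨N₃, h₃⟩ := ncoeff_eventually B v
  have hswap : ∀ m : ℤ, ∀ j : ℕ, N₁ ≤ j → N₂ ≤ j →
      signedSwap (VertexOperator.ncoeff A j) (VertexOperator.ncoeff B (p + m - j)) v = 0 := by
    intro m j hj₁ hj₂
    simp [signedSwap, h₁ j hj₁, h₂ j hj₂]
  set J : ℕ := (max N₁ N₂).toNat with hJ
  have hJ₁ : N₁ ≤ J := by omega
  have hJ₂ : N₂ ≤ J := by omega
  -- uniform bound for the finitely many remaining second terms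
  have hfin : ∃ K : ℤ, ∀ m ≥ K, ∀ j < J,
      signedSwap (VertexOperator.ncoeff A j) (VertexOperator.ncoeff B (p + m - j)) v = 0 := by
    have hall : ∀ j : ℕ, ∃ K : ℤ, ∀ m ≥ K,
        signedSwap (VertexOperator.ncoeff A j) (VertexOperator.ncoeff B (p + m - j)) v = 0 := by
      intro j
      obtain ⟨K₁, k₁⟩ := ncoeff_eventually B (VertexOperator.ncoeff A j v)
      obtain ⟨K₂, k₂⟩ := ncoeff_eventually B (parity (VertexOperator.ncoeff A j (parity v)))
      obtain ⟨K₃, k₃⟩ := ncoeff_eventually B (parity (VertexOperator.ncoeff A j v))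
      obtain ⟨K₄, k₄⟩ :=
        ncoeff_eventually B (parity (parity (VertexOperator.ncoeff A j (parity v))))
      refine ⟨max (max K₁ K₂) (max K₃ K₄) - p + j, fun m hm => ?_⟩
      simp [signedSwap, k₁ (p + m - j) (by omega), k₂ (p + m - j) (by omega),
        k₃ (p + m - j) (by omega), k₄ (p + m - j) (by omega)]
    choose K hK using hall
    refine ⟨∑ j ∈ Finset.range J, |K j|, fun m hm j hj => hK j m ?_⟩
    have h5 : |K j| ≤ ∑ j ∈ Finset.range J, |K j| :=
      Finset.single_le_sum (f := fun j => |K j|) (fun _ _ => abs_nonneg _)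
        (Finset.mem_range.2 hj)
    exact le_trans (le_abs_self _) (le_trans h5 hm)
  obtain ⟨K, hK⟩ := hfin
  refine ⟨J, max N₃ K, fun m j hj hm => ?_, fun m hm j => ?_⟩
  · simp [prodTerm, h₃ (m + j) (by omega), hswap m j (by omega) (by omega)]
  · have h6 : signedSwap (VertexOperator.ncoeff A j) (VertexOperator.ncoeff B (p + m - j)) v
        = 0 := by
      rcases lt_or_ge j J with hj | hj
      · exact hK m (by omega) j hj
      · exact hswap m j (by omega) (by omega)
    simp [prodTerm, h₃ (m + j) (by omega), h6]

theorem prodTerm_finite (A : FockField n) (p : ℤ) (B : FockField n) (m : ℤ) (v : Fock n) :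
    (Function.support fun j => prodTerm A p B m j v).Finite := by
  obtain ⟨J, M, h, -⟩ := prodTerm_bound A p B v
  refine (Set.finite_lt_nat (max J (M - m).toNat)).subset fun j hj => ?_
  by_contra hlt
  have hlt' : max J (M - m).toNat ≤ j := not_lt.1 hlt
  exact hj (h m j (by omega) (by omega))

/-- The mode
`(A_{(p)} B)_{(m)} = ∑_{j ≥ 0} (-1)^j (p choose j)
  (A_{(p-j)} B_{(m+j)} - (-1)^{p + |A||B|} B_{(p+m-j)} A_{(j)})`,
a finite sum on every vector. -/
def prodMode (A : FockField n) (p : ℤ) (B : FockField n) (m : ℤ) : Module.End ℂ (Fock n) where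
  toFun v := ∑ᶠ j : ℕ, prodTerm A p B m j v
  map_add' v w := by
    simp only [map_add]
    exact finsum_add_distrib (prodTerm_finite A p B m v) (prodTerm_finite A p B m w)
  map_smul' r v := by
    simp only [map_smul, RingHom.id_apply]
    exact (smul_finsum' r (prodTerm_finite A p B m v)).symm

/-- The product `(A_{(p)} B)(w) = ∮ dz/(2πi) (z - w)^p A(z) B(w)` of fields (radially ordered
contour integral around `w`). -/
def prod (A : FockField n) (p : ℤ) (B : FockField n) : FockField n :=
  ofModes (prodMode A p B) (fun v => by
    obtain ⟨-, M, -, h⟩ := prodTerm_bound A p B v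
    refine ⟨M, fun m hm => ?_⟩
    change (∑ᶠ j : ℕ, prodTerm A p B m j v) = 0
    simp [h m hm])

/-- The normally ordered product `(AB)_0`, the coefficient of `(z - w)^0` in `A(z) B(w)`. Longer
products are nested to the right, `ABC = A(BC)`. -/
def nop (A B : FockField n) : FockField n := prod A (-1) B

/-- The vertex algebra generated by a set `S` of fields: the smallest linear space of fields that
contains `S` and the identity field and is closed under all the products `A_{(p)} B`, `p ∈ ℤ`
(hence under `∂A = A_{(-2)} 1`). -/
def generatedBy (S : Set (FockField n)) : Submodule ℂ (FockField n) :=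
  sInf {M | one ∈ M ∧ S ⊆ M ∧ ∀ A ∈ M, ∀ B ∈ M, ∀ p : ℤ, prod A p B ∈ M}

/-- The vertex algebra of the symplectic bosons, the fermi multiplets and the ghosts. -/
def fullAlgebra (n : ℕ) : Submodule ℂ (FockField n) :=
  generatedBy (Set.range X ∪ Set.range Y ∪ Set.range psi ∪ Set.range chi ∪ Set.range b ∪
    Set.range c)

/-! ### BRST reduction -/

/-- The `a`-th index among the `n` flavours, for `a = 1, …, n - 1`. -/
def node (a : Fin (n - 1)) : Fin n := ⟨a, by omega⟩

/-- The index `a + 1` among the `n` flavours, for `a = 1, …, n - 1`. -/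
def nodeSucc (a : Fin (n - 1)) : Fin n := ⟨a + 1, by omega⟩

/-- `J_BRST = ∑_a c^a (X_a Y_a - X_{a+1} Y_{a+1} + ψ_a χ_a - ψ_{a+1} χ_{a+1})`. -/
def currentBRST (n : ℕ) : FockField n :=
  ∑ a : Fin (n - 1), nop (c a)
    (nop (X (node a)) (Y (node a)) - nop (X (nodeSucc a)) (Y (nodeSucc a)) +
      nop (psi (node a)) (chi (node a)) - nop (psi (nodeSucc a)) (chi (nodeSucc a)))

/-- The action `A ↦ Q A = ∮ dz/(2πi) J_BRST(z) A(w)` of the BRST charge on fields; its modes are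
the supercommutators of `Q = (J_BRST)_{(0)}` with the modes of `A`. -/
def Q (A : FockField n) : FockField n := prod (currentBRST n) 0 A

/-- `A ≡ B`: the difference `A - B` is `Q`-exact. -/
def BRSTEquiv (A B : FockField n) : Prop := ∃ C ∈ fullAlgebra n, A - B = Q C

/-! ### The operators -/

/-- `𝒜_i = -X_i Y_i`. -/
def calA (i : Fin n) : FockField n := -nop (X i) (Y i)

/-- `Â_i 𝒪 = (𝒜_i 𝒪)_0`. -/
def hatA (i : Fin n) (O : FockField n) : FockField n := nop (calA i) O

/-- `𝒟_i 𝒪 = (𝒜_i 𝒪)_0 + (X_i (Y_i 𝒪)_0)_0`. -/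
def calD (i : Fin n) (O : FockField n) : FockField n := nop (calA i) O + nop (X i) (nop (Y i) O)

/-- `T_i = (1/2) (𝒟_i + Â_i) 𝒜_i`. -/
def T (i : Fin n) : FockField n := (1 / 2 : ℂ) • (calD i (calA i) + hatA i (calA i))

/-- `W_i = (1/3) √(2/3) {𝒟_i 𝒟_i 𝒜_i + (1/2) 𝒟_i Â_i 𝒜_i + (1/2) Â_i 𝒟_i 𝒜_i + Â_i Â_i 𝒜_i}`. -/
def W (i : Fin n) : FockField n :=
  ((1 / 3 : ℂ) * (Real.sqrt (2 / 3) : ℂ)) •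
    (calD i (calD i (calA i)) + (1 / 2 : ℂ) • calD i (hatA i (calA i)) +
      (1 / 2 : ℂ) • hatA i (calD i (calA i)) + hatA i (hatA i (calA i)))

/-- `U = -(1/n) ∑_i X_i Y_i`. -/
def U (n : ℕ) : FockField n := (-(1 / (n : ℂ))) • ∑ i : Fin n, nop (X i) (Y i)

/-- `U_F = -(1/n) ∑_i ψ_i χ_i`. -/
def UF (n : ℕ) : FockField n := (-(1 / (n : ℂ))) • ∑ i : Fin n, nop (psi i) (chi i)

/-- `M_i^+ = X_i ψ_i`. -/
def Mplus (i : Fin n) : FockField n := nop (X i) (psi i)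

/-- `M_i^- = Y_i χ_i`. -/
def Mminus (i : Fin n) : FockField n := nop (Y i) (chi i)

/-- `[A, B] = (AB)_0 - (BA)_0`, the commutator for the normally ordered product. -/
def nopComm (A B : FockField n) : FockField n := nop A B - nop B A

end BoundaryVOA

end

open BoundaryVOA (W T U UF Mplus Mminus nop der nopComm Q BRSTEquiv generatedBy)

/-!
Up to normal ordering, `T_i` and `W_i` are expressions in the current `-(X_i Y_i + ψ_i χ_i)` and in
`M_i^±`: applied to the vacuum, the modes of `X_i Y_i`, `ψ_i χ_i`, `X_i ψ_i` and `Y_i χ_i` can be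
commuted past the creation modes of the free fields, so that the two identities become equalities of
polynomials in creation modes. The currents `X_i Y_i + ψ_i χ_i` at two adjacent nodes differ by
`Q b_a`; hence each `-(X_i Y_i + ψ_i χ_i)` is cohomologous to the average `U + U_F`. Finally `Q` is
an odd derivation of all the products `A_{(p)} B`, so that the products descend to cohomology and
the current may be replaced by `U + U_F` inside any expression in closed fields.
-/

open scoped TensorProduct

noncomputable section

namespace BoundaryVOA

variable {n : ℕ}

open VertexOperator (ncoeff)

open Finset.HasAntidiagonal (antidiagonal mem_antidiagonal)

/-! ### Pointwise finite sums of operators -/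

section PointwiseSums

variable {R V ι κ : Type*} [CommRing R] [AddCommGroup V] [Module R V]

/-- A family of operators is pointwise finite if only finitely many of its members act nontrivially
on any given vector. -/
def PointwiseFinite (f : ι → Module.End R V) : Prop :=
  ∀ v, (Function.support fun i => f i v).Finite

/-- The operator `S` is the sum of the pointwise finite family `f`. Infinite sums of modes of
fields, such as those of `prodMode`, are meant in this sense. -/
structure HasPointwiseSum (f : ι → Module.End R V) (S : Module.End R V) : Prop where
  finite : PointwiseFinite f
  finsum_apply : ∀ v, ∑ᶠ i, f i v = S v

namespace PointwiseFinite

variable {f g : ι → Module.End R V}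

theorem add (hf : PointwiseFinite f) (hg : PointwiseFinite g) :
    PointwiseFinite fun i => f i + g i := fun v =>
  ((hf v).union (hg v)).subset (Function.support_add _ _)

theorem mul_left (hf : PointwiseFinite f) (g : ι → Module.End R V) :
    PointwiseFinite fun i => g i * f i := fun v =>
  (hf v).subset fun i hi h => hi (by simp only [Module.End.mul_apply, h, map_zero])

theorem smul (hf : PointwiseFinite f) (c : ι → R) : PointwiseFinite fun i => c i • f i := by
  simpa only [smul_mul_assoc, one_mul] using hf.mul_left fun i => c i • 1

theorem sub (hf : PointwiseFinite f) (hg : PointwiseFinite g) :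
    PointwiseFinite fun i => f i - g i := by
  simpa only [neg_one_smul, ← sub_eq_add_neg] using hf.add (hg.smul fun _ => -1)

theorem comp_equiv (hf : PointwiseFinite f) (e : κ ≃ ι) : PointwiseFinite fun k => f (e k) :=
  fun v => (hf v).preimage e.injective.injOn

theorem comp_add {f : ℕ → Module.End R V} (hf : PointwiseFinite f) :
    PointwiseFinite fun ij : ℕ × ℕ => f (ij.1 + ij.2) := fun v =>
  ((hf v).biUnion fun l _ => (antidiagonal l).finite_toSet).subset fun ij hij =>
    Set.mem_biUnion (x := ij.1 + ij.2) hij (mem_antidiagonal.2 rfl)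

theorem mul_curry (hf : PointwiseFinite f) {g : ι → κ → Module.End R V}
    (hg : ∀ i, PointwiseFinite (g i)) :
    PointwiseFinite fun ij : ι × κ => g ij.1 ij.2 * f ij.1 := fun v => by
  refine ((hf v).biUnion fun i _ => (hg i (f i v)).image (Prod.mk i)).subset ?_
  rintro ⟨i, j⟩ hij
  have hi : f i v ≠ 0 := fun h => hij (by simp only [Module.End.mul_apply, h, map_zero])
  exact Set.mem_biUnion (x := i) hi ⟨j, hij, rfl⟩

end PointwiseFinite

namespace HasPointwiseSum

variable {f g : ι → Module.End R V} {S T : Module.End R V}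

theorem unique (hS : HasPointwiseSum f S) (hT : HasPointwiseSum f T) : S = T :=
  LinearMap.ext fun v => (hS.finsum_apply v).symm.trans (hT.finsum_apply v)

theorem congr (hf : HasPointwiseSum f S) (h : ∀ i, f i = g i) : HasPointwiseSum g S :=
  funext h ▸ hf

theorem add (hf : HasPointwiseSum f S) (hg : HasPointwiseSum g T) :
    HasPointwiseSum (fun i => f i + g i) (S + T) :=
  ⟨hf.finite.add hg.finite, fun v => by
    simpa only [LinearMap.add_apply, hf.finsum_apply, hg.finsum_apply] using
      finsum_add_distrib (hf.finite v) (hg.finite v)⟩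

theorem mul_left (L : Module.End R V) (hf : HasPointwiseSum f S) :
    HasPointwiseSum (fun i => L * f i) (L * S) :=
  ⟨hf.finite.mul_left _, fun v => by
    simp only [Module.End.mul_apply, ← hf.finsum_apply, map_finsum L (hf.finite v)]⟩

theorem mul_right (hf : HasPointwiseSum f S) (L : Module.End R V) :
    HasPointwiseSum (fun i => f i * L) (S * L) :=
  ⟨fun v => hf.finite (L v), fun v => hf.finsum_apply (L v)⟩

theorem smul (c : R) (hf : HasPointwiseSum f S) : HasPointwiseSum (fun i => c • f i) (c • S) := by
  simpa only [smul_mul_assoc, one_mul] using hf.mul_left (c • 1)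

theorem sub (hf : HasPointwiseSum f S) (hg : HasPointwiseSum g T) :
    HasPointwiseSum (fun i => f i - g i) (S - T) := by
  simpa only [neg_one_smul, ← sub_eq_add_neg] using hf.add (hg.smul (-1))

theorem of_eq_single {i : ι} (h : ∀ j ≠ i, f j = 0) : HasPointwiseSum f (f i) :=
  ⟨fun _ => (Set.finite_singleton i).subset fun j hj => by_contra fun hji =>
      hj (by simp only [h j hji, LinearMap.zero_apply]),
    fun _ => finsum_eq_single _ _ fun j hj => by rw [h j hj, LinearMap.zero_apply]⟩

theorem zero : HasPointwiseSum (fun _ : ι => (0 : Module.End R V)) 0 :=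
  ⟨fun _ => by simp, fun _ => by simp⟩

theorem comp_equiv (hf : HasPointwiseSum f S) (e : κ ≃ ι) :
    HasPointwiseSum (fun k => f (e k)) S :=
  ⟨hf.finite.comp_equiv e, fun v => (finsum_comp_equiv e).trans (hf.finsum_apply v)⟩

theorem uncurry {f : ι × κ → Module.End R V} {g : ι → Module.End R V} (hf : PointwiseFinite f)
    (hg : ∀ i, HasPointwiseSum (fun j => f (i, j)) (g i)) (hS : HasPointwiseSum g S) :
    HasPointwiseSum f S :=
  ⟨hf, fun v => by
    simp only [finsum_curry _ (hf v), (hg _).finsum_apply, hS.finsum_apply]⟩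

theorem sum_antidiagonal {f : ℕ × ℕ → Module.End R V} (hf : HasPointwiseSum f S) :
    HasPointwiseSum (fun l => ∑ ij ∈ antidiagonal l, f ij) S := by
  let s (v : V) : Finset (ℕ × ℕ) := (hf.finite v).toFinset
  have hsum (l : ℕ) (v : V) : (∑ ij ∈ antidiagonal l, f ij) v =
      ∑ ij ∈ s v with ij.1 + ij.2 = l, f ij v := by
    rw [LinearMap.sum_apply]
    refine (Finset.sum_subset (fun ij h => mem_antidiagonal.2 (Finset.mem_filter.1 h).2)
      fun ij h₁ h₂ => ?_).symm
    by_contra hne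
    exact h₂ (Finset.mem_filter.2 ⟨(hf.finite v).mem_toFinset.2 hne, mem_antidiagonal.1 h₁⟩)
  have hsupport (v : V) := (s v).support_of_fiberwise_sum_subset_image (fun ij => f ij v)
    fun ij => ij.1 + ij.2
  simp only [← hsum] at hsupport
  refine ⟨fun v => (Finset.finite_toSet _).subset (hsupport v), fun v => ?_⟩
  rw [finsum_eq_sum_of_support_subset _ (hsupport v), ← hf.finsum_apply,
    finsum_eq_sum _ (hf.finite v)]
  simp only [hsum]
  exact Finset.sum_fiberwise_of_maps_to (fun ij h => Finset.mem_image_of_mem _ h) _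

theorem sub_succ {G : ℕ → Module.End R V} (hG : PointwiseFinite G) :
    HasPointwiseSum (fun j => G j - G (j + 1)) (G 0) := by
  have hG' : PointwiseFinite fun j => G (j + 1) := fun v =>
    (hG v).preimage (add_left_injective 1).injOn
  refine ⟨hG.sub hG', fun v => ?_⟩
  obtain ⟨N, hN⟩ : ∃ N, ∀ j ≥ N, G j v = 0 := by
    obtain ⟨N, hN⟩ := (hG v).bddAbove
    exact ⟨N + 1, fun j hj => by_contra fun hne => absurd (hN hne) (by omega)⟩
  rw [finsum_eq_sum_of_support_subset (s := Finset.range N)]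
  · simp only [LinearMap.sub_apply]
    rw [Finset.sum_range_sub' (fun j => G j v), hN N le_rfl, sub_zero]
  · intro j hj
    by_contra hlt
    simp only [Finset.coe_range, Set.mem_Iio, not_lt] at hlt
    exact hj (by simp only [LinearMap.sub_apply, hN j hlt, hN (j + 1) (by omega), sub_zero])

end HasPointwiseSum

end PointwiseSums

/-! ### Modes and parity of fields -/

theorem field_ext {A B : FockField n} (h : ∀ m : ℤ, ncoeff A m = ncoeff B m) : A = B :=
  HVertexOperator.coeff_inj (funext fun k => by simpa using h (-k - 1))

theorem ncoeff_one (m : ℤ) : ncoeff (one : FockField n) m = if m = -1 then 1 else 0 :=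
  ncoeff_ofModes _ _ m

theorem ncoeff_der (A : FockField n) (m : ℤ) :
    ncoeff (der A) m = (-(m : ℂ)) • ncoeff A (m - 1) :=
  ncoeff_ofModes _ _ m

theorem ncoeff_add (A B : FockField n) (m : ℤ) : ncoeff (A + B) m = ncoeff A m + ncoeff B m := by
  rw [map_add, Pi.add_apply]

theorem ncoeff_smul (r : ℂ) (A : FockField n) (m : ℤ) : ncoeff (r • A) m = r • ncoeff A m := by
  rw [map_smul, Pi.smul_apply]

theorem ncoeff_zero (m : ℤ) : ncoeff (0 : FockField n) m = 0 := by rw [map_zero, Pi.zero_apply]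

theorem pointwiseFinite_ncoeff_add (A : FockField n) (m : ℤ) :
    PointwiseFinite fun j : ℕ => ncoeff A (m + j) := fun v => by
  obtain ⟨N, hN⟩ := ncoeff_eventually A v
  exact (Set.finite_lt_nat (N - m).toNat).subset fun j hj =>
    Int.lt_toNat.2 (lt_sub_iff_add_lt'.2 (not_le.1 fun hle => hj (hN (m + j) hle)))

theorem pointwiseFinite_ncoeff (A : FockField n) : PointwiseFinite fun j : ℕ => ncoeff A j := by
  simpa only [zero_add] using pointwiseFinite_ncoeff_add A 0

theorem hasPointwiseSum_prod (A : FockField n) (p : ℤ) (B : FockField n) (m : ℤ) :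
    HasPointwiseSum (prodTerm A p B m) (ncoeff (prod A p B) m) :=
  ⟨prodTerm_finite A p B m, fun v => by rw [prod, ncoeff_ofModes]; rfl⟩

/-- The sign `(-1)^e` of a parity `e`. -/
def koszulSign (e : ZMod 2) : ℂ := (-1) ^ e.val

theorem koszulSign_zero : koszulSign 0 = 1 := pow_zero _

theorem koszulSign_one : koszulSign 1 = -1 := pow_one _

theorem koszulSign_eq_or (e : ZMod 2) : koszulSign e = 1 ∨ koszulSign e = -1 :=
  neg_one_pow_eq_or ℂ _

theorem koszulSign_mul_self (e : ZMod 2) : koszulSign e * koszulSign e = 1 := by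
  rcases koszulSign_eq_or e with h | h <;> rw [h] <;> norm_num

theorem koszulSign_add (e f : ZMod 2) : koszulSign (e + f) = koszulSign e * koszulSign f := by
  rw [koszulSign, koszulSign, koszulSign, ZMod.val_add, ← neg_one_pow_eq_pow_mod_two, pow_add]

theorem parity_mul_self : (parity : Module.End ℂ (Fock n)) * parity = 1 := by
  rw [parity, Module.End.mul_eq_comp, ← LinearEquiv.conj_comp, ← LinearMap.lTensor_comp,
    ← AlgHom.comp_toLinearMap, CliffordAlgebra.involute_comp_involute, AlgHom.toLinearMap_id,
    LinearMap.lTensor_id, LinearEquiv.conj_id, Module.End.one_eq_id]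

/-- Conjugation of operators by the parity involution `(-1)^F`. -/
def parityConj : Module.End ℂ (Fock n) →ₐ[ℂ] Module.End ℂ (Fock n) :=
  AlgHom.ofLinearMap ((LinearMap.mulLeft ℂ parity).comp (LinearMap.mulRight ℂ parity))
    (by simp [parity_mul_self])
    (fun x y => calc
      parity * (x * y * parity) = parity * x * 1 * y * parity := by simp only [mul_assoc, one_mul]
      _ = parity * (x * parity) * (parity * (y * parity)) := by
        simp only [← parity_mul_self, mul_assoc])

theorem parityConj_apply (x : Module.End ℂ (Fock n)) : parityConj x = parity * x * parity :=
  (mul_assoc _ _ _).symm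

theorem parityConj_parityConj (x : Module.End ℂ (Fock n)) : parityConj (parityConj x) = x := by
  simp only [parityConj_apply, mul_assoc, parity_mul_self, mul_one]
  rw [← mul_assoc, parity_mul_self, one_mul]

theorem HasPointwiseSum.parityConj {ι : Type*} {f : ι → Module.End ℂ (Fock n)}
    {S : Module.End ℂ (Fock n)} (h : HasPointwiseSum f S) :
    HasPointwiseSum (fun i => parityConj (f i)) (parityConj S) := by
  simpa only [← mul_assoc, ← parityConj_apply] using (h.mul_right parity).mul_left parity

theorem signedSwap_eq (x y : Module.End ℂ (Fock n)) :
    signedSwap x y = y * ((1 / 2 : ℂ) • (x + parityConj x)) +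
      parityConj y * ((1 / 2 : ℂ) • (x - parityConj x)) := by
  simp only [signedSwap, parityConj_apply]

theorem signedSwap_add_left (x x' y : Module.End ℂ (Fock n)) :
    signedSwap (x + x') y = signedSwap x y + signedSwap x' y := by
  simp only [signedSwap_eq, map_add, mul_add, mul_smul_comm, mul_sub]
  module

theorem signedSwap_smul_left (r : ℂ) (x y : Module.End ℂ (Fock n)) :
    signedSwap (r • x) y = r • signedSwap x y := by
  simp only [signedSwap_eq, map_smul, mul_add, mul_smul_comm, mul_sub]
  module

theorem signedSwap_add_right (x y y' : Module.End ℂ (Fock n)) :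
    signedSwap x (y + y') = signedSwap x y + signedSwap x y' := by
  simp only [signedSwap_eq, map_add, add_mul]
  abel

theorem signedSwap_smul_right (r : ℂ) (x y : Module.End ℂ (Fock n)) :
    signedSwap x (r • y) = r • signedSwap x y := by
  simp only [signedSwap_eq, map_smul, smul_mul_assoc, smul_add]

theorem signedSwap_zero_left (y : Module.End ℂ (Fock n)) : signedSwap 0 y = 0 := by
  simpa using signedSwap_smul_left 0 0 y

theorem signedSwap_zero_right (x : Module.End ℂ (Fock n)) : signedSwap x 0 = 0 := by
  simpa using signedSwap_smul_right 0 x 0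

theorem signedSwap_one_right (x : Module.End ℂ (Fock n)) : signedSwap x 1 = x := by
  simp only [signedSwap_eq, map_one, one_mul]
  module

theorem parityConj_signedSwap (x y : Module.End ℂ (Fock n)) :
    parityConj (signedSwap x y) = signedSwap (parityConj x) (parityConj y) := by
  simp only [signedSwap_eq, map_add, map_sub, map_smul, map_mul]

/-- The automorphism `A ↦ (-1)^F A (-1)^F` of the linear space of fields. -/
def conj : Module.End ℂ (FockField n) where
  toFun A := ofModes (fun m => parityConj (ncoeff A m)) fun v => by
    obtain ⟨N, hN⟩ := ncoeff_eventually A (parity v)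
    refine ⟨N, fun m hm => ?_⟩
    rw [parityConj_apply, Module.End.mul_apply, Module.End.mul_apply, hN m hm, map_zero]
  map_add' A B := field_ext fun m => by simp only [ncoeff_add, ncoeff_ofModes, map_add]
  map_smul' r A := field_ext fun m => by
    simp only [ncoeff_smul, ncoeff_ofModes, map_smul, RingHom.id_apply]

theorem ncoeff_conj (A : FockField n) (m : ℤ) : ncoeff (conj A) m = parityConj (ncoeff A m) :=
  ncoeff_ofModes _ _ m

theorem conj_conj (A : FockField n) : conj (conj A) = A :=
  field_ext fun m => by rw [ncoeff_conj, ncoeff_conj, parityConj_parityConj]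

/-- The fields of parity `e`, that is, of statistics `(-1)^e`. -/
def fieldsOfParity (n : ℕ) (e : ZMod 2) : Submodule ℂ (FockField n) :=
  conj.eigenspace (koszulSign e)

theorem mem_fieldsOfParity {e : ZMod 2} {A : FockField n} :
    A ∈ fieldsOfParity n e ↔ conj A = koszulSign e • A :=
  Module.End.mem_eigenspace_iff

/-- The `e`-th power of `conj`: moving a field of parity `e` past `B` turns `B` into
`twist e B`. -/
def twist (e : ZMod 2) : Module.End ℂ (FockField n) := conj ^ e.val

theorem twist_zero (A : FockField n) : twist 0 A = A := rfl

theorem twist_one (A : FockField n) : twist 1 A = conj A := rfl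

theorem twist_twist (e f : ZMod 2) (A : FockField n) : twist e (twist f A) = twist (e + f) A := by
  have h : (conj : Module.End ℂ (FockField n)) ^ 2 = 1 := LinearMap.ext conj_conj
  rw [twist, twist, twist, ← Module.End.mul_apply, ← pow_add, ZMod.val_add,
    ← pow_eq_pow_mod _ h]

theorem twist_of_mem_fieldsOfParity {e : ZMod 2} {A : FockField n} (hA : A ∈ fieldsOfParity n e)
    (f : ZMod 2) : twist f A = koszulSign (f * e) • A := by
  rcases (by decide : ∀ f : ZMod 2, f = 0 ∨ f = 1) f with rfl | rfl
  · rw [twist_zero, zero_mul, koszulSign_zero, one_smul]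
  · rw [twist_one, one_mul, mem_fieldsOfParity.1 hA]

theorem signedSwap_ncoeff {e : ZMod 2} {A : FockField n} (hA : A ∈ fieldsOfParity n e)
    (B : FockField n) (k l : ℤ) :
    signedSwap (ncoeff A k) (ncoeff B l) = ncoeff (twist e B) l * ncoeff A k := by
  rw [signedSwap_eq, ← ncoeff_conj, mem_fieldsOfParity.1 hA, ncoeff_smul]
  rcases (by decide : ∀ e : ZMod 2, e = 0 ∨ e = 1) e with rfl | rfl
  · rw [twist_zero, koszulSign_zero]
    simp only [mul_smul_comm, mul_add, mul_sub]
    module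
  · rw [twist_one, koszulSign_one, ncoeff_conj]
    simp only [mul_smul_comm, mul_add, mul_sub]
    module

theorem one_mem_fieldsOfParity : one ∈ fieldsOfParity n 0 := by
  refine mem_fieldsOfParity.2 (field_ext fun m => ?_)
  rw [koszulSign_zero, one_smul, ncoeff_conj, ncoeff_one]
  split_ifs
  exacts [map_one _, map_zero _]

theorem conj_prod (A : FockField n) (p : ℤ) (B : FockField n) :
    conj (prod A p B) = prod (conj A) p (conj B) := by
  refine field_ext fun m => HasPointwiseSum.unique ?_ (hasPointwiseSum_prod (conj A) p (conj B) m)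
  rw [ncoeff_conj]
  refine (hasPointwiseSum_prod A p B m).parityConj.congr fun j => ?_
  simp only [prodTerm, ncoeff_conj, map_smul, map_sub, map_mul, parityConj_signedSwap]

/-! ### Elementary properties of the products -/

/-- The product `A_{(p)} B` as a bilinear map. -/
def prodₗ (p : ℤ) : FockField n →ₗ[ℂ] FockField n →ₗ[ℂ] FockField n :=
  LinearMap.mk₂ ℂ (fun A B => prod A p B)
    (fun A A' B => field_ext fun m => (hasPointwiseSum_prod (A + A') p B m).unique <| by
      rw [ncoeff_add]
      refine ((hasPointwiseSum_prod A p B m).add (hasPointwiseSum_prod A' p B m)).congr fun j => ?_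
      simp only [prodTerm, ncoeff_add, signedSwap_add_left, add_mul]
      module)
    (fun r A B => field_ext fun m => (hasPointwiseSum_prod (r • A) p B m).unique <| by
      rw [ncoeff_smul]
      refine ((hasPointwiseSum_prod A p B m).smul r).congr fun j => ?_
      simp only [prodTerm, ncoeff_smul, signedSwap_smul_left, smul_mul_assoc]
      module)
    (fun A B B' => field_ext fun m => (hasPointwiseSum_prod A p (B + B') m).unique <| by
      rw [ncoeff_add]
      refine ((hasPointwiseSum_prod A p B m).add (hasPointwiseSum_prod A p B' m)).congr fun j => ?_
      simp only [prodTerm, ncoeff_add, signedSwap_add_right, mul_add]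
      module)
    (fun r A B => field_ext fun m => (hasPointwiseSum_prod A p (r • B) m).unique <| by
      rw [ncoeff_smul]
      refine ((hasPointwiseSum_prod A p B m).smul r).congr fun j => ?_
      simp only [prodTerm, ncoeff_smul, signedSwap_smul_right, mul_smul_comm]
      module)

theorem prodₗ_apply (p : ℤ) (A B : FockField n) : prodₗ p A B = prod A p B := rfl

theorem prod_smul_left (r : ℂ) (A : FockField n) (p : ℤ) (B : FockField n) :
    prod (r • A) p B = r • prod A p B := (prodₗ p).map_smul₂ r A B

theorem prod_smul_right (r : ℂ) (A : FockField n) (p : ℤ) (B : FockField n) :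
    prod A p (r • B) = r • prod A p B := (prodₗ p A).map_smul r B

theorem prod_zero_right (A : FockField n) (p : ℤ) : prod A p 0 = 0 := (prodₗ p A).map_zero

theorem prod_mem_fieldsOfParity {e f : ZMod 2} {A B : FockField n} (hA : A ∈ fieldsOfParity n e)
    (hB : B ∈ fieldsOfParity n f) (p : ℤ) : prod A p B ∈ fieldsOfParity n (e + f) := by
  rw [mem_fieldsOfParity] at *
  rw [conj_prod, hA, hB, prod_smul_left, prod_smul_right, smul_smul, koszulSign_add]

theorem twist_prod (e : ZMod 2) (A : FockField n) (p : ℤ) (B : FockField n) :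
    twist e (prod A p B) = prod (twist e A) p (twist e B) := by
  rcases (by decide : ∀ e : ZMod 2, e = 0 ∨ e = 1) e with rfl | rfl
  exacts [rfl, conj_prod A p B]

/-- The coefficient `(-1)^j (p choose j)` of `z^{p-j} w^j` in `(z - w)^p`. -/
def binCoeff (p : ℤ) (j : ℕ) : ℂ := (-1 : ℂ) ^ j * ((Ring.choose p j : ℤ) : ℂ)

theorem prodTerm_eq (A : FockField n) (p : ℤ) (B : FockField n) (m : ℤ) (j : ℕ) :
    prodTerm A p B m j = binCoeff p j • (ncoeff A (p - j) * ncoeff B (m + j) -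
      (-1 : ℂ) ^ p • signedSwap (ncoeff A j) (ncoeff B (p + m - j))) := rfl

theorem binCoeff_neg_one (j : ℕ) : binCoeff (-1) j = 1 := by
  have h : Ring.choose (-1 : ℤ) j = (-1) ^ j := by
    rw [Ring.choose_neg, add_sub_cancel_left, Ring.choose_natCast, Nat.choose_self]
    simp [Int.negOnePow_def, Units.smul_def]
  rw [binCoeff, h, Int.cast_pow, Int.cast_neg, Int.cast_one, ← mul_pow, neg_one_mul, neg_neg,
    one_pow]

theorem sum_binCoeff_mul (p q : ℤ) (l : ℕ) :
    ∑ ij ∈ antidiagonal l, binCoeff p ij.1 * binCoeff q ij.2 = binCoeff (p + q) l := by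
  simp only [binCoeff]
  rw [Ring.add_choose_eq l (Commute.all p q), Int.cast_sum, Finset.mul_sum]
  refine Finset.sum_congr rfl fun ij hij => ?_
  rw [← mem_antidiagonal.1 hij, pow_add, Int.cast_mul]
  ring

theorem succ_mul_binCoeff_succ (p : ℤ) (j : ℕ) :
    ((j : ℂ) + 1) * binCoeff p (j + 1) = -(p * binCoeff (p - 1) j) := by
  have h : ((j : ℂ) + 1) * (Ring.choose p (j + 1) : ℤ) = p * (Ring.choose (p - 1) j : ℤ) := by
    have := Ring.choose_smul_choose p (Nat.le_add_left 1 j)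
    simp only [Nat.choose_one_right, Ring.choose_one_right, nsmul_eq_mul, Nat.cast_one,
      Nat.add_sub_cancel] at this
    exact_mod_cast this
  simp only [binCoeff, pow_succ]
  linear_combination -(-1 : ℂ) ^ j * h

theorem sub_mul_binCoeff (p : ℤ) (j : ℕ) :
    ((p : ℂ) - j) * binCoeff p j = p * binCoeff (p - 1) j := by
  have h : ((j : ℂ) + 1) * (Ring.choose p (j + 1) : ℤ) = (p - j) * (Ring.choose p j : ℤ) := by
    have := Ring.choose_smul_choose p (Nat.le_add_right j 1)
    simp only [Nat.choose_succ_self_right, Ring.choose_one_right, nsmul_eq_mul,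
      Nat.add_sub_cancel_left, mul_comm (Ring.choose p j)] at this
    exact_mod_cast this
  have h' := succ_mul_binCoeff_succ p j
  simp only [binCoeff, pow_succ] at h' ⊢
  linear_combination -h' - (-1 : ℂ) ^ j * h

theorem der_prod (A : FockField n) (p : ℤ) (B : FockField n) :
    der (prod A p B) = (-(p : ℂ)) • prod A (p - 1) B + prod A p (der B) := by
  refine field_ext fun m => sub_eq_zero.1 ?_
  let G (j : ℕ) : Module.End ℂ (Fock n) :=
    ((j : ℂ) * binCoeff p j) • (ncoeff A (p - j) * ncoeff B (m - 1 + j))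
  have hG : HasPointwiseSum (fun j => G j - G (j + 1)) 0 := by
    simpa [G] using HasPointwiseSum.sub_succ
      (((pointwiseFinite_ncoeff_add B (m - 1)).mul_left _).smul _ : PointwiseFinite G)
  refine HasPointwiseSum.unique ?_ hG
  rw [ncoeff_der, ncoeff_add, ncoeff_smul]
  refine (((hasPointwiseSum_prod A p B (m - 1)).smul _).sub
    (((hasPointwiseSum_prod A (p - 1) B m).smul _).add
      (hasPointwiseSum_prod A p (der B) m))).congr fun j => ?_
  have hsucc := succ_mul_binCoeff_succ p j
  have hsub := sub_mul_binCoeff p j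
  simp only [G, prodTerm_eq, ncoeff_der, signedSwap_smul_right, mul_smul_comm,
    zpow_sub_one₀ (neg_ne_zero.2 one_ne_zero : (-1 : ℂ) ≠ 0), Nat.cast_succ, hsucc]
  rw [show p - 1 - (j : ℤ) = p - (j + 1) by ring, show m - 1 + ((j : ℤ) + 1) = m + j by ring,
    show m + (j : ℤ) - 1 = m - 1 + j by ring, show p - 1 + m - (j : ℤ) = p + (m - 1) - j by ring,
    show p + m - (j : ℤ) - 1 = p + (m - 1) - j by ring]
  push_cast
  match_scalars
  · ring
  · linear_combination -(-1 : ℂ) ^ p * hsub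
  · ring

theorem prodTerm_one_right (A : FockField n) (p m : ℤ) (j : ℕ) :
    prodTerm A p one m j = binCoeff p j • ((if m + j = -1 then ncoeff A (p - j) else 0) -
      (-1 : ℂ) ^ p • (if p + m - j = -1 then ncoeff A j else 0)) := by
  rw [prodTerm, ncoeff_one, ncoeff_one]
  split_ifs <;> simp only [mul_one, mul_zero, signedSwap_one_right, signedSwap_zero_right] <;> rfl

theorem prod_neg_one_one (A : FockField n) : prod A (-1) one = A := by
  refine field_ext fun m => ?_
  obtain ⟨i, rfl | rfl⟩ : ∃ i : ℕ, m = -1 - i ∨ m = i := by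
    rcases lt_or_ge m 0 with hm | hm
    exacts [⟨(-1 - m).toNat, .inl (by omega)⟩, ⟨m.toNat, .inr (by omega)⟩]
  all_goals
    rw [(hasPointwiseSum_prod A (-1) one _).unique
      (HasPointwiseSum.of_eq_single (i := i) fun j hj => by
        rw [prodTerm_one_right, if_neg (by omega), if_neg (by omega), smul_zero, sub_zero,
          smul_zero]), prodTerm_one_right, binCoeff_neg_one, one_smul]
  · rw [if_pos (by omega), if_neg (by omega), smul_zero, sub_zero]
  · rw [if_neg (by omega), if_pos (by omega)]
    simp

theorem der_one : der (one : FockField n) = 0 := by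
  refine field_ext fun m => ?_
  rw [ncoeff_der, ncoeff_one, ncoeff_zero]
  split_ifs with h
  · rw [sub_eq_neg_self.1 h, Int.cast_zero, neg_zero, zero_smul]
  · rw [smul_zero]

theorem prod_neg_two_one (A : FockField n) : prod A (-2) one = der A := by
  have h := der_prod A (-1) one
  rw [prod_neg_one_one, der_one, prod_zero_right, add_zero] at h
  rw [h]
  norm_num

theorem prod_one_of_lt {r : ℤ} (hr : r < -1) (B : FockField n) : prod one r B = 0 := by
  refine field_ext fun m => (hasPointwiseSum_prod one r B m).unique ?_
  rw [ncoeff_zero]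
  refine HasPointwiseSum.zero.congr fun j => ?_
  rw [prodTerm, ncoeff_one, ncoeff_one, if_neg (by omega), if_neg (by omega),
    signedSwap_zero_left, zero_mul, smul_zero, sub_zero, smul_zero]

theorem ncoeff_prod_zero (A B : FockField n) (m : ℤ) :
    ncoeff (prod A 0 B) m = ncoeff A 0 * ncoeff B m - signedSwap (ncoeff A 0) (ncoeff B m) := by
  have h := (hasPointwiseSum_prod A 0 B m).unique
    (HasPointwiseSum.of_eq_single (i := 0) fun j hj => by
      rw [prodTerm, Ring.choose_zero_pos ℤ (Nat.pos_of_ne_zero hj), Int.cast_zero, mul_zero,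
        zero_smul])
  simpa [prodTerm] using h

/-! ### Zero modes of odd fields -/

/-- The supercommutator `[q, x}` with an odd operator `q`. -/
def superComm (q : Module.End ℂ (Fock n)) : Module.End ℂ (Module.End ℂ (Fock n)) :=
  LinearMap.mulLeft ℂ q - LinearMap.mulRight ℂ q ∘ₗ parityConj.toLinearMap

theorem superComm_apply (q x : Module.End ℂ (Fock n)) :
    superComm q x = q * x - parityConj x * q := rfl

theorem superComm_mul (q x y : Module.End ℂ (Fock n)) :
    superComm q (x * y) = superComm q x * y + parityConj x * superComm q y := by
  simp only [superComm_apply, map_mul]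
  noncomm_ring

theorem superComm_signedSwap {q : Module.End ℂ (Fock n)} (hq : parityConj q = -q)
    (x y : Module.End ℂ (Fock n)) :
    superComm q (signedSwap x y) =
      signedSwap (superComm q x) y + signedSwap (parityConj x) (superComm q y) := by
  simp only [superComm_apply, signedSwap_eq, map_add, map_sub, map_mul, map_smul, hq,
    parityConj_parityConj, mul_smul_comm, mul_add, mul_sub, sub_mul,
    mul_neg, neg_mul, ← mul_assoc]
  module

theorem HasPointwiseSum.superComm (q : Module.End ℂ (Fock n)) {ι : Type*}
    {f : ι → Module.End ℂ (Fock n)} {S : Module.End ℂ (Fock n)} (h : HasPointwiseSum f S) :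
    HasPointwiseSum (fun i => superComm q (f i)) (superComm q S) :=
  (h.mul_left q).sub (h.parityConj.mul_right q)

theorem ncoeff_prod_zero_of_odd {J : FockField n} (hJ : J ∈ fieldsOfParity n 1) (A : FockField n)
    (m : ℤ) : ncoeff (prod J 0 A) m = superComm (ncoeff J 0) (ncoeff A m) := by
  rw [ncoeff_prod_zero, signedSwap_ncoeff hJ, twist_one, ncoeff_conj, superComm_apply]

theorem prod_zero_prod {J : FockField n} (hJ : J ∈ fieldsOfParity n 1) (A : FockField n) (p : ℤ)
    (B : FockField n) :
    prod J 0 (prod A p B) = prod (prod J 0 A) p B + prod (conj A) p (prod J 0 B) := by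
  have hq : parityConj (ncoeff J 0) = -ncoeff J 0 := by
    rw [← ncoeff_conj, mem_fieldsOfParity.1 hJ, koszulSign_one, ncoeff_smul, neg_one_smul]
  refine field_ext fun m => ?_
  rw [ncoeff_prod_zero_of_odd hJ, ncoeff_add]
  refine ((hasPointwiseSum_prod A p B m).superComm _).unique
    (((hasPointwiseSum_prod (prod J 0 A) p B m).add
      (hasPointwiseSum_prod (conj A) p (prod J 0 B) m)).congr fun j => ?_)
  simp only [prodTerm_eq, ncoeff_prod_zero_of_odd hJ, ncoeff_conj, map_smul, map_sub,
    superComm_mul, superComm_signedSwap hq]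
  module

/-! ### Operator product expansions -/

/-- The operator product expansion `A(z) B(w) ∼ r / (z - w)^2 + ρ(w) / (z - w)` of fields of
parities `e` and `f`, as a commutation relation of modes. -/
structure HasOPE (e f : ZMod 2) (A B ρ : FockField n) (r : ℂ) : Prop where
  left : A ∈ fieldsOfParity n e
  right : B ∈ fieldsOfParity n f
  mode_mul : ∀ k l : ℤ, ncoeff A k * ncoeff B l =
    koszulSign (e * f) • (ncoeff B l * ncoeff A k) + ncoeff ρ (k + l) +
      ((k : ℂ) * r) • ncoeff one (k + l - 1)

namespace HasOPE

variable {e f : ZMod 2} {A A' B ρ ρ' : FockField n} {r r' : ℂ}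

theorem ncoeff_residue (h : HasOPE e f A B ρ r) (m : ℤ) :
    ncoeff ρ m = ncoeff A 0 * ncoeff B m - koszulSign (e * f) • (ncoeff B m * ncoeff A 0) := by
  rw [h.mode_mul 0 m, zero_add, Int.cast_zero, zero_mul, zero_smul, add_zero, add_sub_cancel_left]

theorem residue_mem (h : HasOPE e f A B ρ r) : ρ ∈ fieldsOfParity n (e + f) := by
  refine mem_fieldsOfParity.2 (field_ext fun m => ?_)
  rw [ncoeff_conj, ncoeff_smul, h.ncoeff_residue]
  simp only [map_sub, map_smul, map_mul, ← ncoeff_conj, mem_fieldsOfParity.1 h.left,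
    mem_fieldsOfParity.1 h.right, ncoeff_smul, koszulSign_add, smul_mul_smul_comm]
  module

theorem mode_mul_of_simple (h : HasOPE e f A B ρ 0) (k l : ℤ) : ncoeff A k * ncoeff B l =
    koszulSign (e * f) • (ncoeff B l * ncoeff A k) + ncoeff ρ (k + l) := by
  rw [h.mode_mul, mul_zero, zero_smul, add_zero]

theorem prod_zero (h : HasOPE e f A B ρ r) : prod A 0 B = ρ := by
  refine field_ext fun m => ?_
  rw [ncoeff_prod_zero, signedSwap_ncoeff h.left, twist_of_mem_fieldsOfParity h.right, ncoeff_smul,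
    smul_mul_assoc, h.ncoeff_residue]

theorem add (h : HasOPE e f A B ρ r) (h' : HasOPE e f A' B ρ' r') :
    HasOPE e f (A + A') B (ρ + ρ') (r + r') where
  left := add_mem h.left h'.left
  right := h.right
  mode_mul k l := by
    simp only [ncoeff_add, add_mul, mul_add, h.mode_mul, h'.mode_mul]
    module

theorem smul (c : ℂ) (h : HasOPE e f A B ρ r) : HasOPE e f (c • A) B (c • ρ) (c * r) where
  left := Submodule.smul_mem _ c h.left
  right := h.right
  mode_mul k l := by
    simp only [ncoeff_smul, smul_mul_assoc, mul_smul_comm, h.mode_mul]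
    module

theorem symm (h : HasOPE e f A B ρ r) :
    HasOPE f e B A (-koszulSign (e * f) • ρ) (koszulSign (e * f) * r) where
  left := h.right
  right := h.left
  mode_mul k l := by
    have hsq := koszulSign_mul_self (e * f)
    rw [mul_comm f, add_comm k l, h.mode_mul l k, ncoeff_smul, ncoeff_one]
    split_ifs with hkl
    · rw [show k = -l by linarith, Int.cast_neg]
      match_scalars
      · linear_combination -hsq
      all_goals ring
    · match_scalars
      · linear_combination -hsq
      all_goals ring

end HasOPE

/-! ### Composition of products -/

/-- The `(i, j)`-th term of the mode `(A_{(p)} (φ_{(q)} B))_{(m)}`, for fields `A` and `φ` of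
parities `e` and `f`. -/
def prodProdTerm (e f : ZMod 2) (A : FockField n) (p : ℤ) (φ : FockField n) (q : ℤ)
    (B : FockField n) (m : ℤ) (ij : ℕ × ℕ) : Module.End ℂ (Fock n) :=
  (binCoeff p ij.1 * binCoeff q ij.2) •
    (ncoeff A (p - ij.1) * (ncoeff φ (q - ij.2) * ncoeff B (m + ij.1 + ij.2)) -
      (-1 : ℂ) ^ q • (ncoeff A (p - ij.1) *
        (ncoeff (twist f B) (q + (m + ij.1) - ij.2) * ncoeff φ ij.2)) -
      ((-1 : ℂ) ^ p * koszulSign (e * f)) •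
        (ncoeff φ (q - ij.2) * (ncoeff (twist e B) (p + m - ij.1 + ij.2) * ncoeff A ij.1)) +
      ((-1 : ℂ) ^ (p + q) * koszulSign (e * f)) •
        (ncoeff (twist (f + e) B) (q + (p + m - ij.1) - ij.2) * (ncoeff φ ij.2 * ncoeff A ij.1)))

theorem pointwiseFinite_prodProdTerm (e f : ZMod 2) (A : FockField n) (p : ℤ) (φ : FockField n)
    (q : ℤ) (B : FockField n) (m : ℤ) :
    PointwiseFinite (prodProdTerm e f A p φ q B m) := by
  have h₁ : PointwiseFinite fun ij : ℕ × ℕ =>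
      ncoeff A (p - ij.1) * (ncoeff φ (q - ij.2) * ncoeff B (m + ij.1 + ij.2)) := by
    simpa only [Nat.cast_add, ← add_assoc] using
      ((pointwiseFinite_ncoeff_add B m).comp_add.mul_left fun ij => ncoeff φ (q - ij.2)).mul_left
        fun ij => ncoeff A (p - ij.1)
  have h₂ : PointwiseFinite fun ij : ℕ × ℕ => ncoeff A (p - ij.1) *
      (ncoeff (twist f B) (q + (m + ij.1) - ij.2) * ncoeff φ ij.2) := by
    refine PointwiseFinite.comp_equiv (f := fun ji : ℕ × ℕ => ncoeff A (p - ji.2) *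
      (ncoeff (twist f B) (q + (m + ji.2) - ji.1) * ncoeff φ ji.1)) ?_ (Equiv.prodComm ℕ ℕ)
    refine PointwiseFinite.mul_left ((pointwiseFinite_ncoeff φ).mul_curry
      (g := fun (j i : ℕ) => ncoeff (twist f B) (q + (m + i) - j)) fun j => ?_) _
    simpa only [← add_assoc, add_sub_right_comm _ _ (j : ℤ)] using
      pointwiseFinite_ncoeff_add (twist f B) (q + m - j)
  have h₃ : PointwiseFinite fun ij : ℕ × ℕ => ncoeff φ (q - ij.2) *
      (ncoeff (twist e B) (p + m - ij.1 + ij.2) * ncoeff A ij.1) :=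
    ((pointwiseFinite_ncoeff A).mul_curry fun i =>
      pointwiseFinite_ncoeff_add (twist e B) (p + m - i)).mul_left _
  have h₄ : PointwiseFinite fun ij : ℕ × ℕ =>
      ncoeff (twist (f + e) B) (q + (p + m - ij.1) - ij.2) * (ncoeff φ ij.2 * ncoeff A ij.1) :=
    ((pointwiseFinite_ncoeff A).mul_curry fun _ => pointwiseFinite_ncoeff φ).mul_left _
  exact (((h₁.sub (h₂.smul _)).sub (h₃.smul _)).add (h₄.smul _)).smul _

theorem hasPointwiseSum_prodProdTerm {e f : ZMod 2} {A φ : FockField n}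
    (hA : A ∈ fieldsOfParity n e) (hφ : φ ∈ fieldsOfParity n f) (p q : ℤ) (B : FockField n)
    (m : ℤ) :
    HasPointwiseSum (prodProdTerm e f A p φ q B m) (ncoeff (prod A p (prod φ q B)) m) := by
  refine .uncurry (pointwiseFinite_prodProdTerm e f A p φ q B m) (fun i => ?_)
    (hasPointwiseSum_prod A p (prod φ q B) m)
  rw [prodTerm_eq, signedSwap_ncoeff hA, twist_prod, twist_of_mem_fieldsOfParity hφ,
    prod_smul_left, ncoeff_smul]
  refine ((((hasPointwiseSum_prod φ q B (m + i)).mul_left _).sub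
    ((((hasPointwiseSum_prod φ q (twist e B) (p + m - i)).smul _).mul_right _).smul _)).smul
      _).congr fun j => ?_
  simp only [prodProdTerm, prodTerm_eq, signedSwap_ncoeff hφ, twist_twist, smul_mul_assoc,
    mul_smul_comm, mul_sub, sub_mul, mul_assoc,
    zpow_add₀ (neg_ne_zero.2 one_ne_zero : (-1 : ℂ) ≠ 0)]
  module

theorem HasOPE.prod_prod {e f : ZMod 2} {A φ ρ : FockField n} (h : HasOPE e f A φ ρ 0) (p q : ℤ)
    (B : FockField n) :
    prod A p (prod φ q B) =
      koszulSign (e * f) • prod φ q (prod A p B) + prod ρ (p + q) B := by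
  refine field_ext fun m => ?_
  rw [ncoeff_add, ncoeff_smul, ← sub_eq_iff_eq_add']
  have hsub := ((hasPointwiseSum_prodProdTerm h.left h.right p q B m).sub
    (((hasPointwiseSum_prodProdTerm h.right h.left q p B m).comp_equiv
      (Equiv.prodComm ℕ ℕ)).smul (koszulSign (e * f)))).sum_antidiagonal
  refine hsub.unique ((hasPointwiseSum_prod ρ (p + q) B m).congr fun l => ?_)
  rw [prodTerm_eq, ← sum_binCoeff_mul, Finset.sum_smul]
  refine Finset.sum_congr rfl fun ij hij => ?_
  obtain ⟨i, j⟩ := ij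
  obtain rfl : i + j = l := mem_antidiagonal.1 hij
  have hleft : ncoeff A (p - i) * (ncoeff φ (q - j) * ncoeff B (m + i + j)) =
      koszulSign (e * f) • (ncoeff φ (q - j) * (ncoeff A (p - i) * ncoeff B (m + i + j))) +
        ncoeff ρ (p + q - ↑(i + j)) * ncoeff B (m + ↑(i + j)) := by
    rw [← mul_assoc, h.mode_mul_of_simple, add_mul, smul_mul_assoc, mul_assoc, Nat.cast_add,
      ← add_assoc m, sub_add_sub_comm]
  have hright := h.mode_mul_of_simple i j
  simp only [prodProdTerm, Equiv.prodComm_apply, Prod.swap_prod_mk,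
    signedSwap_ncoeff h.residue_mem, hleft, hright, mul_add, mul_smul_comm,
    show q + (m + (i : ℤ)) - j = q + m - j + i by ring,
    show q + (p + m - (i : ℤ)) - j = p + q + m - ↑(i + j) by push_cast; ring,
    show p + (m + (j : ℤ)) - i = p + m - i + j by ring,
    show p + (q + m - (j : ℤ)) - i = p + q + m - ↑(i + j) by push_cast; ring,
    mul_comm f e, add_comm f e, add_comm q p, add_right_comm m (j : ℤ) i, Nat.cast_add]
  have hsq := koszulSign_mul_self (e * f)
  set x : ℂ := binCoeff p i * binCoeff q j * (-1) ^ (p + q)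
  match_scalars
  all_goals first
    | ring1
    | linear_combination x * hsq
    | linear_combination -(binCoeff p i * binCoeff q j * (-1) ^ q) * hsq
    | linear_combination x * koszulSign (e * f) * hsq

/-! ### Wick's theorem -/

/-- The terms of the mode `(A B)_{(k + m)}` of a normally ordered product, with the modes `A_{(l)}`
for `l < k`, instead of `l < 0`, taken as the creation part of `A`. -/
def nopTerm (e f : ZMod 2) (A B : FockField n) (k m : ℤ) (j : ℕ) : Module.End ℂ (Fock n) :=
  ncoeff A (k - 1 - j) * ncoeff B (m + j) +
    koszulSign (e * f) • (ncoeff B (m - 1 - j) * ncoeff A (k + j))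

theorem hasPointwiseSum_nop {e f : ZMod 2} {A B : FockField n} (hA : A ∈ fieldsOfParity n e)
    (hB : B ∈ fieldsOfParity n f) (m : ℤ) :
    HasPointwiseSum (nopTerm e f A B 0 m) (ncoeff (nop A B) m) := by
  refine (hasPointwiseSum_prod A (-1) B m).congr fun j => ?_
  rw [prodTerm_eq, binCoeff_neg_one, signedSwap_ncoeff hA, twist_of_mem_fieldsOfParity hB,
    ncoeff_smul, smul_mul_assoc, nopTerm, zero_sub, zero_add, neg_add_eq_sub 1 m, zpow_neg_one]
  module

theorem hasPointwiseSum_nopTerm_sub {e f : ZMod 2} {A B ρ : FockField n}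
    (h : HasOPE e f A B ρ 0) (k m : ℤ) :
    HasPointwiseSum (fun j => nopTerm e f A B (k + 1) (m - 1) j - nopTerm e f A B k m j)
      (ncoeff ρ (k + m - 1)) := by
  have hG : PointwiseFinite fun j : ℕ => ncoeff A (k - j) * ncoeff B (m - 1 + j) -
      koszulSign (e * f) • (ncoeff B (m - 1 - j) * ncoeff A (k + j)) :=
    ((pointwiseFinite_ncoeff_add B (m - 1)).mul_left _).sub
      (((pointwiseFinite_ncoeff_add A k).mul_left _).smul _)
  have hG₀ : ncoeff ρ (k + m - 1) = ncoeff A (k - (0 : ℕ)) * ncoeff B (m - 1 + (0 : ℕ)) -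
      koszulSign (e * f) • (ncoeff B (m - 1 - (0 : ℕ)) * ncoeff A (k + (0 : ℕ))) := by
    rw [Nat.cast_zero, sub_zero, add_zero, sub_zero, add_zero, h.mode_mul_of_simple,
      add_sub_cancel_left, add_sub_assoc]
  rw [hG₀]
  refine (HasPointwiseSum.sub_succ hG).congr fun j => ?_
  simp only [nopTerm, add_sub_cancel_right, Nat.cast_add, Nat.cast_one,
    show k - ((j : ℤ) + 1) = k - 1 - j by ring, show m - 1 + ((j : ℤ) + 1) = m + j by ring,
    show m - 1 - ((j : ℤ) + 1) = m - 1 - 1 - j by ring,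
    show k + ((j : ℤ) + 1) = k + 1 + j by ring]
  module

theorem hasPointwiseSum_nopTerm {e f : ZMod 2} {A B : FockField n} {r : ℂ}
    (h : HasOPE e f A B (r • one) 0) (k m : ℤ) :
    HasPointwiseSum (nopTerm e f A B k m)
      (ncoeff (nop A B) (k + m) + ((k : ℂ) * r) • ncoeff one (k + m - 1)) := by
  induction k using Int.induction_on generalizing m with
  | zero =>
    simpa only [zero_add, Int.cast_zero, zero_mul, zero_smul, add_zero] using
      hasPointwiseSum_nop h.left h.right m
  | succ k ih =>
    have hstep := (ih (m + 1)).add (hasPointwiseSum_nopTerm_sub h k (m + 1))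
    simp only [add_sub_cancel_right, add_sub_cancel] at hstep
    convert hstep using 1
    rw [ncoeff_smul, add_right_comm, ← add_assoc, add_sub_cancel_right, Int.cast_add, Int.cast_one]
    module
  | pred k ih =>
    have hstep := (ih (m - 1)).sub (hasPointwiseSum_nopTerm_sub h (-k - 1) m)
    simp only [sub_add_cancel, sub_sub_cancel] at hstep
    convert hstep using 1
    rw [ncoeff_smul, ← add_sub_assoc, sub_add_eq_add_sub, Int.cast_sub, Int.cast_one]
    module

theorem HasOPE.mul_mul_ncoeff {e f g : ZMod 2} {A B K ρ τ : FockField n}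
    (hA : HasOPE e g A K ρ 0) (hB : HasOPE f g B K τ 0) (p q l : ℤ) :
    ncoeff A p * ncoeff B q * ncoeff K l =
      koszulSign ((e + f) * g) • (ncoeff K l * (ncoeff A p * ncoeff B q)) +
        (ncoeff A p * ncoeff τ (q + l) + koszulSign (f * g) • (ncoeff ρ (p + l) * ncoeff B q)) := by
  rw [mul_assoc, hB.mode_mul_of_simple, mul_add, mul_smul_comm, ← mul_assoc,
    hA.mode_mul_of_simple, add_mul, smul_mul_assoc, mul_assoc, add_mul, koszulSign_add]
  module

theorem HasOPE.nop_left {e f g : ZMod 2} {A B K ρ τ : FockField n} {r : ℂ}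
    (hA : HasOPE e g A K ρ 0) (hB : HasOPE f g B K τ 0)
    (hρ : HasOPE (e + g) f ρ B (r • one) 0) :
    HasOPE (e + f) g (nop A B) K (nop A τ + koszulSign (f * g) • nop ρ B)
      (-koszulSign (f * g) * r) where
  left := prod_mem_fieldsOfParity hA.left hB.left _
  right := hA.right
  mode_mul m l := by
    have hcomm : HasPointwiseSum
        (fun j => nopTerm e (f + g) A τ 0 (m + l) j +
          koszulSign (f * g) • nopTerm (e + g) f ρ B l m j)
        (ncoeff (nop A B) m * ncoeff K l -
          koszulSign ((e + f) * g) • (ncoeff K l * ncoeff (nop A B) m)) := by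
      have hAB := hasPointwiseSum_nop hA.left hB.left m
      refine ((hAB.mul_right (ncoeff K l)).sub ((hAB.mul_left (ncoeff K l)).smul _)).congr
        fun j => ?_
      simp only [nopTerm, add_mul, mul_add, smul_mul_assoc, mul_smul_comm, zero_sub, zero_add,
        hA.mul_mul_ncoeff hB, hB.mul_mul_ncoeff hA, koszulSign_add,
        mul_comm g f, add_comm f e, show m + (j : ℤ) + l = m + l + j by ring,
        show m - 1 - (j : ℤ) + l = m + l - 1 - j by ring,
        show -1 - (j : ℤ) + l = l - 1 - j by ring, add_comm (j : ℤ) l]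
      match_scalars
      all_goals first
        | ring1
        | linear_combination -koszulSign (e * f) * koszulSign_mul_self (f * g)
    have hsum := hcomm.unique ((hasPointwiseSum_nop hA.left hB.residue_mem (m + l)).add
      ((hasPointwiseSum_nopTerm hρ l m).smul _))
    rw [sub_eq_iff_eq_add'] at hsum
    rw [hsum, ncoeff_add, ncoeff_smul, add_comm l m, ncoeff_one]
    split_ifs with hml
    · rw [show l = -m by linarith, Int.cast_neg]
      module
    · module

/-! ### Creation and annihilation operators -/

theorem pderiv_pderiv_comm {R σ : Type*} [CommRing R] (s t : σ) (p : MvPolynomial σ R) :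
    MvPolynomial.pderiv s (MvPolynomial.pderiv t p) =
      MvPolynomial.pderiv t (MvPolynomial.pderiv s p) := by
  classical
  have h : ⁅MvPolynomial.pderiv (R := R) s, MvPolynomial.pderiv (R := R) t⁆ = 0 := by
    refine MvPolynomial.derivation_ext fun x => ?_
    rw [Derivation.commutator_apply, MvPolynomial.pderiv_X, MvPolynomial.pderiv_X]
    simp only [Pi.single_apply]
    split_ifs <;> simp
  rw [← sub_eq_zero, ← Derivation.commutator_apply, h, Derivation.zero_apply]

theorem involute_contractLeft {R M : Type*} [CommRing R] [AddCommGroup M] [Module R M]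
    {Q : QuadraticForm R M} (d : Module.Dual R M) (w : CliffordAlgebra Q) :
    CliffordAlgebra.involute (CliffordAlgebra.contractLeft d w) =
      -CliffordAlgebra.contractLeft d (CliffordAlgebra.involute w) := by
  induction w using CliffordAlgebra.left_induction with
  | algebraMap r => simp [CliffordAlgebra.contractLeft_algebraMap]
  | add x y hx hy => rw [map_add, map_add, hx, hy, map_add, map_add, neg_add]
  | ι_mul x m hx =>
    rw [CliffordAlgebra.contractLeft_ι_mul, map_sub, map_mul, map_mul, map_smul, hx,
      CliffordAlgebra.involute_ι, neg_mul, neg_mul, map_neg,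
      CliffordAlgebra.contractLeft_ι_mul]
    simp

/-- Operators on the bosonic factor, as operators on the Fock space. -/
def onBosons : Module.End ℂ (BosonFock n) →ₐ[ℂ] Module.End ℂ (Fock n) :=
  ((fockEquiv (n := n)).conjAlgEquiv ℂ).toAlgHom.comp
    (Module.End.rTensorAlgHom ℂ (BosonFock n) (FermionFock n))

/-- Operators on the fermionic factor, as operators on the Fock space. They are not twisted by the
parity of the other factor, which is even. -/
def onFermions : Module.End ℂ (FermionFock n) →ₐ[ℂ] Module.End ℂ (Fock n) :=
  ((fockEquiv (n := n)).conjAlgEquiv ℂ).toAlgHom.comp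
    (Module.End.lTensorAlgHom ℂ (FermionFock n) (BosonFock n))

theorem onBosons_mul_onFermions (x : Module.End ℂ (BosonFock n))
    (y : Module.End ℂ (FermionFock n)) : onBosons x * onFermions y = onFermions y * onBosons x := by
  change fockEquiv.conjAlgEquiv ℂ (x.rTensor (FermionFock n)) *
      fockEquiv.conjAlgEquiv ℂ (y.lTensor (BosonFock n)) =
    fockEquiv.conjAlgEquiv ℂ (y.lTensor (BosonFock n)) *
      fockEquiv.conjAlgEquiv ℂ (x.rTensor (FermionFock n))
  rw [← map_mul, ← map_mul, Module.End.mul_eq_comp, Module.End.mul_eq_comp,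
    LinearMap.rTensor_comp_lTensor, LinearMap.lTensor_comp_rTensor]

theorem createB_eq (s : Boson n) (k : ℕ) :
    createB s k = onBosons (LinearMap.mulLeft ℂ (MvPolynomial.X (s, k))) := rfl

theorem removeB_eq (s : Boson n) (k : ℕ) :
    removeB s k = onBosons (MvPolynomial.pderiv (s, k)).toLinearMap := rfl

theorem createF_eq (s : Fermion n) (k : ℕ) : createF s k =
    onFermions (LinearMap.mulLeft ℂ (ExteriorAlgebra.ι ℂ (Finsupp.single (s, k) 1))) := rfl

theorem removeF_eq (s : Fermion n) (k : ℕ) : removeF s k =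
    onFermions (CliffordAlgebra.contractLeft (Finsupp.lapply (s, k))) := rfl

theorem parity_eq :
    (parity : Module.End ℂ (Fock n)) = onFermions CliffordAlgebra.involute.toLinearMap := rfl

theorem parityConj_onBosons (x : Module.End ℂ (BosonFock n)) :
    parityConj (onBosons x) = onBosons x := by
  rw [parityConj_apply, parity_eq, mul_assoc, onBosons_mul_onFermions, ← parity_eq, ← mul_assoc,
    parity_mul_self, one_mul]

theorem parityConj_createF (s : Fermion n) (k : ℕ) : parityConj (createF s k) = -createF s k := by
  rw [parityConj_apply, parity_eq, createF_eq, ← map_mul, ← map_mul, ← map_neg]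
  refine congrArg onFermions (LinearMap.ext fun w => ?_)
  simp only [Module.End.mul_apply, AlgHom.toLinearMap_apply, LinearMap.mulLeft_apply,
    LinearMap.neg_apply, map_mul, CliffordAlgebra.involute_involute, ← neg_mul]
  exact congrArg (· * w) (CliffordAlgebra.involute_ι _)

theorem parityConj_removeF (s : Fermion n) (k : ℕ) : parityConj (removeF s k) = -removeF s k := by
  rw [parityConj_apply, parity_eq, removeF_eq, ← map_mul, ← map_mul, ← map_neg]
  refine congrArg onFermions (LinearMap.ext fun w => ?_)
  simp only [Module.End.mul_apply, AlgHom.toLinearMap_apply, LinearMap.neg_apply,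
    involute_contractLeft, CliffordAlgebra.involute_involute]

theorem createB_mul_createB (s t : Boson n) (k l : ℕ) :
    createB s k * createB t l = createB t l * createB s k := by
  simp only [createB_eq, ← map_mul]
  exact congrArg onBosons (LinearMap.ext fun p => mul_left_comm _ _ p)

theorem removeB_mul_removeB (s t : Boson n) (k l : ℕ) :
    removeB s k * removeB t l = removeB t l * removeB s k := by
  simp only [removeB_eq, ← map_mul]
  exact congrArg onBosons (LinearMap.ext fun p => pderiv_pderiv_comm _ _ p)

open scoped Classical in
theorem removeB_mul_createB (s t : Boson n) (k l : ℕ) :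
    removeB s k * createB t l =
      createB t l * removeB s k + (if (s, k) = (t, l) then (1 : ℂ) else 0) • 1 := by
  rw [removeB_eq, createB_eq, ← map_one onBosons, ← map_mul, ← map_mul, ← map_smul, ← map_add]
  refine congrArg onBosons (LinearMap.ext fun p => ?_)
  simp only [Module.End.mul_apply, LinearMap.add_apply, LinearMap.mulLeft_apply,
    LinearMap.smul_apply, Module.End.one_apply, Derivation.coeFn_coe, Derivation.leibniz,
    MvPolynomial.pderiv_X, Pi.single_apply, smul_eq_mul, eq_comm (a := (t, l))]
  split_ifs <;> simp

theorem createF_mul_createF (s t : Fermion n) (k l : ℕ) :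
    createF s k * createF t l = -(createF t l * createF s k) := by
  simp only [createF_eq, ← map_mul, ← map_neg]
  refine congrArg onFermions (LinearMap.ext fun w => ?_)
  simp only [Module.End.mul_apply, LinearMap.neg_apply, LinearMap.mulLeft_apply, ← mul_assoc]
  rw [← neg_mul, eq_neg_of_add_eq_zero_left (ExteriorAlgebra.ι_add_mul_swap _ _)]

theorem removeF_mul_removeF (s t : Fermion n) (k l : ℕ) :
    removeF s k * removeF t l = -(removeF t l * removeF s k) := by
  simp only [removeF_eq, ← map_mul, ← map_neg]
  exact congrArg onFermions (LinearMap.ext fun w => CliffordAlgebra.contractLeft_comm _ _ w)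

open scoped Classical in
theorem removeF_mul_createF (s t : Fermion n) (k l : ℕ) :
    removeF s k * createF t l =
      -(createF t l * removeF s k) + (if (s, k) = (t, l) then (1 : ℂ) else 0) • 1 := by
  rw [removeF_eq, createF_eq, ← map_one onFermions, ← map_mul, ← map_mul, ← map_smul, ← map_neg,
    ← map_add]
  refine congrArg onFermions (LinearMap.ext fun w => ?_)
  refine (CliffordAlgebra.contractLeft_ι_mul _ _ _).trans ?_
  rw [sub_eq_neg_add, Finsupp.lapply_apply, Finsupp.single_apply]
  simp only [eq_comm (a := (t, l))]
  rfl

/-! ### The generating fields -/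

/-- The label of the symplectic boson conjugate to a given one. -/
def Boson.dual : Boson n → Boson n
  | .X i => .Y i
  | .Y i => .X i

/-- The residue of the operator product of a symplectic boson with its conjugate. -/
def Boson.sign : Boson n → ℂ
  | .X _ => 1
  | .Y _ => -1

/-- The label of the fermi multiplet or ghost conjugate to a given one. -/
def Fermion.dual : Fermion n → Fermion n
  | .psi i => .chi i
  | .chi i => .psi i
  | .b a => .c a
  | .c a => .b a

/-- The labels of the generating fields. -/
abbrev Generator (n : ℕ) : Type := Boson n ⊕ Fermion n

namespace Generator

/-- The generating field with a given label. -/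
def field : Generator n → FockField n
  | .inl (.X i) => X i
  | .inl (.Y i) => Y i
  | .inr (.psi i) => psi i
  | .inr (.chi i) => chi i
  | .inr (.b a) => b a
  | .inr (.c a) => c a

/-- The parity of a generating field. -/
def degree : Generator n → ZMod 2
  | .inl _ => 0
  | .inr _ => 1

open scoped Classical in
/-- The residue of the simple pole in the operator product of two generating fields. -/
def pairing : Generator n → Generator n → ℂ
  | .inl s, .inl t => if s.dual = t then s.sign else 0
  | .inr s, .inr t => if s.dual = t then 1 else 0
  | _, _ => 0

/-- The modes of negative index of a generating field. -/
def create : Generator n → ℕ → Module.End ℂ (Fock n)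
  | .inl s => createB s
  | .inr s => createF s

/-- The modes of nonnegative index of a generating field. -/
def annihilate : Generator n → ℕ → Module.End ℂ (Fock n)
  | .inl s => fun k => s.sign • removeB s.dual k
  | .inr s => removeF s.dual

theorem ncoeff_field (s : Generator n) (m : ℤ) :
    ncoeff s.field m = freeMode s.create s.annihilate m := by
  rcases s with (i | i) | (i | i | a | a)
  · rw [field, X, ncoeff_ofModes]
    simp only [create, annihilate, Boson.sign, Boson.dual, one_smul]
  · rw [field, Y, ncoeff_ofModes]
    simp only [create, annihilate, Boson.sign, Boson.dual, neg_one_smul]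
  all_goals exact ncoeff_ofModes _ (freeMode_eventually _ _ (removeF_eventually _)) m

theorem parityConj_create (s : Generator n) (k : ℕ) :
    parityConj (s.create k) = koszulSign s.degree • s.create k := by
  rcases s with s | s
  · simp only [create, degree, createB_eq, parityConj_onBosons, koszulSign_zero, one_smul]
  · simp only [create, degree, parityConj_createF, koszulSign_one, neg_one_smul]

theorem parityConj_annihilate (s : Generator n) (k : ℕ) :
    parityConj (s.annihilate k) = koszulSign s.degree • s.annihilate k := by
  rcases s with s | s
  · simp only [annihilate, degree, removeB_eq, map_smul, parityConj_onBosons, koszulSign_zero,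
      one_smul]
  · simp only [annihilate, degree, parityConj_removeF, koszulSign_one, neg_one_smul]

theorem field_mem (s : Generator n) : s.field ∈ fieldsOfParity n s.degree := by
  refine mem_fieldsOfParity.2 (field_ext fun m => ?_)
  rw [ncoeff_conj, ncoeff_smul, ncoeff_field]
  rcases m with k | k
  exacts [parityConj_annihilate s k, parityConj_create s k]

theorem pairing_symm (s t : Generator n) :
    t.pairing s = -koszulSign (s.degree * t.degree) * s.pairing t := by
  rcases s with (i | i) | (i | i | a | a) <;> rcases t with (j | j) | (j | j | b | b) <;>
    simp [pairing, degree, Boson.dual, Boson.sign, Fermion.dual, koszulSign_zero, koszulSign_one,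
      eq_comm]

theorem create_mul_create (s t : Generator n) (k l : ℕ) :
    s.create k * t.create l = koszulSign (s.degree * t.degree) • (t.create l * s.create k) := by
  rcases s with s | s <;> rcases t with t | t <;>
    simp only [create, degree, mul_zero, mul_one, koszulSign_zero, koszulSign_one, one_smul,
      neg_one_smul]
  · exact createB_mul_createB s t k l
  · rw [createB_eq, createF_eq, onBosons_mul_onFermions]
  · rw [createB_eq, createF_eq, onBosons_mul_onFermions]
  · exact createF_mul_createF s t k l

theorem annihilate_mul_annihilate (s t : Generator n) (k l : ℕ) :
    s.annihilate k * t.annihilate l =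
      koszulSign (s.degree * t.degree) • (t.annihilate l * s.annihilate k) := by
  rcases s with s | s <;> rcases t with t | t <;>
    simp only [annihilate, degree, mul_zero, mul_one, koszulSign_zero, koszulSign_one, one_smul,
      neg_one_smul, smul_mul_assoc, mul_smul_comm]
  · rw [removeB_mul_removeB, smul_comm]
  · rw [removeB_eq, removeF_eq, onBosons_mul_onFermions]
  · rw [removeB_eq, removeF_eq, onBosons_mul_onFermions]
  · exact removeF_mul_removeF _ _ k l

theorem annihilate_mul_create (s t : Generator n) (k l : ℕ) :
    s.annihilate k * t.create l = koszulSign (s.degree * t.degree) • (t.create l * s.annihilate k) +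
      (if k = l then s.pairing t else 0) • 1 := by
  classical
  rcases s with s | s <;> rcases t with t | t <;>
    simp only [annihilate, create, pairing, degree, mul_zero, mul_one, koszulSign_zero,
      koszulSign_one, one_smul, neg_one_smul, smul_mul_assoc, mul_smul_comm, ite_self, zero_smul,
      add_zero]
  · rw [removeB_mul_createB, smul_add, smul_smul, mul_ite, mul_one, mul_zero]
    simp only [← ite_and, Prod.mk.injEq, and_comm]
  · rw [removeB_eq, createF_eq, onBosons_mul_onFermions]
  · rw [createB_eq, removeF_eq, onBosons_mul_onFermions]
  · rw [removeF_mul_createF]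
    simp only [← ite_and, Prod.mk.injEq, and_comm]

theorem hasOPE (s t : Generator n) :
    HasOPE s.degree t.degree s.field t.field (s.pairing t • one) 0 where
  left := s.field_mem
  right := t.field_mem
  mode_mul k l := by
    simp only [ncoeff_field, ncoeff_smul, ncoeff_one, mul_zero, zero_smul, add_zero]
    rcases k with k | k <;> rcases l with l | l <;> simp only [freeMode]
    · rw [if_neg (by simp only [Int.ofNat_eq_natCast]; lia), smul_zero, add_zero,
        annihilate_mul_annihilate]
    · have hkl : Int.ofNat k + Int.negSucc l = -1 ↔ k = l := by
        simp only [Int.ofNat_eq_natCast]; lia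
      simp only [annihilate_mul_create, hkl, ite_smul, zero_smul, smul_ite, smul_zero]
    · have hkl : Int.negSucc k + Int.ofNat l = -1 ↔ l = k := by
        simp only [Int.ofNat_eq_natCast]; lia
      rw [annihilate_mul_create, pairing_symm s t, mul_comm t.degree, smul_add, smul_smul,
        koszulSign_mul_self, one_smul, add_assoc]
      simp only [hkl, ite_smul, zero_smul, smul_ite, smul_zero]
      split_ifs
      · rw [smul_smul, ← mul_assoc, mul_neg, koszulSign_mul_self]
        module
      · rw [add_zero, add_zero]
    · rw [if_neg (by lia), smul_zero, add_zero, create_mul_create]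

end Generator

/-! ### Bilinears in the generating fields -/

theorem prod_one_neg_one (B : FockField n) : prod one (-1) B = B := by
  refine field_ext fun m => ?_
  have hterm : ∀ j : ℕ, prodTerm one (-1) B m j = if j = 0 then ncoeff B m else 0 := fun j => by
    rw [prodTerm_eq, binCoeff_neg_one, ncoeff_one, ncoeff_one,
      if_neg (c := (j : ℤ) = -1) (by omega), signedSwap_zero_left, smul_zero, sub_zero, one_smul]
    rcases eq_or_ne j 0 with rfl | hj
    · simp
    · rw [if_neg hj, if_neg (by omega), zero_mul]
  rw [(hasPointwiseSum_prod one (-1) B m).unique (HasPointwiseSum.of_eq_single (i := 0)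
    fun j hj => by rw [hterm, if_neg hj]), hterm, if_pos rfl]

theorem nop_smul_one_left (r : ℂ) (B : FockField n) : nop (r • one) B = r • B := by
  rw [nop, prod_smul_left, prod_one_neg_one]

theorem nop_smul_one_right (A : FockField n) (r : ℂ) : nop A (r • one) = r • A := by
  rw [nop, prod_smul_right, prod_neg_one_one]

theorem eq_zero_of_mem_fieldsOfParity {A : FockField n} (h₀ : A ∈ fieldsOfParity n 0)
    (h₁ : A ∈ fieldsOfParity n 1) : A = 0 := by
  have hneg := (mem_fieldsOfParity.1 h₀).symm.trans (mem_fieldsOfParity.1 h₁)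
  rw [koszulSign_zero, koszulSign_one] at hneg
  have htwo : (2 : ℂ) • A = 0 :=
    calc (2 : ℂ) • A = (1 : ℂ) • A - (-1 : ℂ) • A := by module
      _ = 0 := sub_eq_zero.2 hneg
  exact (smul_eq_zero.1 htwo).resolve_left two_ne_zero

theorem HasOPE.smul_one_left {e f : ZMod 2} {r : ℂ} {B : FockField n}
    (hr : r • one ∈ fieldsOfParity n e) (hB : B ∈ fieldsOfParity n f) :
    HasOPE e f (r • one) B 0 0 where
  left := hr
  right := hB
  mode_mul k l := by
    have hcomm : ncoeff (r • one) k * ncoeff B l = ncoeff B l * ncoeff (r • one) k := by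
      rw [ncoeff_smul, ncoeff_one]
      split_ifs <;> simp
    have hsign : koszulSign (e * f) • ncoeff (r • one : FockField n) k = ncoeff (r • one) k := by
      obtain rfl | rfl : e = 0 ∨ e = 1 := by clear hr hB hcomm; decide +revert
      · rw [zero_mul, koszulSign_zero, one_smul]
      · have hzero := eq_zero_of_mem_fieldsOfParity
          (Submodule.smul_mem _ r one_mem_fieldsOfParity) hr
        rw [hzero, ncoeff_zero, smul_zero]
    rw [hcomm, ← mul_smul_comm, hsign, ncoeff_zero, mul_zero, zero_smul, add_zero, add_zero]

namespace Generator

theorem nop_hasOPE (s t u : Generator n) :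
    HasOPE (s.degree + t.degree) u.degree (nop s.field t.field) u.field
      (t.pairing u • s.field + (koszulSign (t.degree * u.degree) * s.pairing u) • t.field) 0 := by
  have hρ := HasOPE.smul_one_left (s.hasOPE u).residue_mem t.field_mem
  have h := (s.hasOPE u).nop_left (t.hasOPE u) (r := 0) (by rwa [zero_smul])
  rwa [nop_smul_one_right, nop_smul_one_left, smul_smul, mul_zero] at h

end Generator

/-- The current `X_i Y_i + ψ_i χ_i`; the gauge currents are the differences of two adjacent ones. -/
def current (i : Fin n) : FockField n := nop (X i) (Y i) + nop (psi i) (chi i)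

/-- The charge of a generating field under a current. -/
def Generator.charge (i : Fin n) : Generator n → ℂ
  | .inl (.X j) => if j = i then -1 else 0
  | .inl (.Y j) => if j = i then 1 else 0
  | .inr (.psi j) => if j = i then 1 else 0
  | .inr (.chi j) => if j = i then -1 else 0
  | .inr (.b _) => 0
  | .inr (.c _) => 0

theorem current_hasOPE_field (i : Fin n) (u : Generator n) :
    HasOPE 0 u.degree (current i) u.field (u.charge i • u.field) 0 := by
  have hXY : HasOPE 0 u.degree (nop (X i) (Y i)) u.field
      (Generator.pairing (.inl (.Y i)) u • X i +
        (koszulSign (0 * u.degree) * Generator.pairing (.inl (.X i)) u) • Y i) 0 :=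
    Generator.nop_hasOPE (.inl (.X i)) (.inl (.Y i)) u
  have hpsichi : HasOPE 0 u.degree (nop (psi i) (chi i)) u.field
      (Generator.pairing (.inr (.chi i)) u • psi i +
        (koszulSign (1 * u.degree) * Generator.pairing (.inr (.psi i)) u) • chi i) 0 :=
    Generator.nop_hasOPE (.inr (.psi i)) (.inr (.chi i)) u
  have hcharge : u.charge i • u.field =
      (Generator.pairing (.inl (.Y i)) u • X i + Generator.pairing (.inl (.X i)) u • Y i) +
      (Generator.pairing (.inr (.chi i)) u • psi i +
        (koszulSign u.degree * Generator.pairing (.inr (.psi i)) u) • chi i) := by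
    rcases u with (j | j) | (j | j | a | a) <;>
      simp only [Generator.charge, Generator.pairing, Generator.field, Generator.degree, Boson.dual,
        Boson.sign, Fermion.dual, Boson.X.injEq, Boson.Y.injEq, Fermion.psi.injEq,
        Fermion.chi.injEq, koszulSign_zero, koszulSign_one, reduceCtorEq, if_false,
        eq_comm (a := i)]
    all_goals first
      | split_ifs with hj
        · subst hj; module
        · module
      | module
  rw [zero_mul, koszulSign_zero, one_mul] at hXY
  rw [one_mul] at hpsichi
  simpa only [hcharge, current, add_zero] using hXY.add hpsichi

theorem Generator.nop_hasOPE_current (s t : Generator n) (i : Fin n) :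
    HasOPE (s.degree + t.degree) 0 (nop s.field t.field) (current i)
      (-(s.charge i + t.charge i) • nop s.field t.field) (s.charge i * s.pairing t) := by
  have hs := (current_hasOPE_field i s).symm
  have ht := (current_hasOPE_field i t).symm
  have hst := (s.hasOPE t).smul (-s.charge i)
  simp only [zero_mul, koszulSign_zero, mul_zero, smul_smul, neg_mul, one_mul] at hs ht hst
  have h := hs.nop_left ht (r := -(s.charge i * s.pairing t)) (by rwa [add_zero])
  simp only [mul_zero, koszulSign_zero, one_smul, neg_mul, one_mul, neg_neg, nop, prod_smul_left,
    prod_smul_right, ← add_smul] at h ⊢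
  rwa [← neg_add_rev] at h

theorem current_hasOPE_current (i j : Fin n) : HasOPE 0 0 (current i) (current j) 0 0 := by
  have hXY : HasOPE 0 0 (nop (X i) (Y i)) (current j) _ _ :=
    Generator.nop_hasOPE_current (.inl (.X i)) (.inl (.Y i)) j
  have hpsichi : HasOPE 0 0 (nop (psi i) (chi i)) (current j) _ _ :=
    Generator.nop_hasOPE_current (.inr (.psi i)) (.inr (.chi i)) j
  have h := hXY.add hpsichi
  rw [← current] at h
  convert h using 1 <;> rcases eq_or_ne i j with rfl | hij <;>
    simp [Generator.charge, Generator.pairing, Boson.dual, Boson.sign, Fermion.dual, *]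

theorem Mplus_hasOPE_current (i j : Fin n) : HasOPE 1 0 (Mplus i) (current j) 0 0 := by
  have h : HasOPE 1 0 (Mplus i) (current j) _ _ :=
    Generator.nop_hasOPE_current (.inl (.X i)) (.inr (.psi i)) j
  convert h using 1
  · simp only [Generator.charge]
    split_ifs <;> simp
  · simp [Generator.pairing]

theorem Mminus_hasOPE_current (i j : Fin n) : HasOPE 1 0 (Mminus i) (current j) 0 0 := by
  have h : HasOPE 1 0 (Mminus i) (current j) _ _ :=
    Generator.nop_hasOPE_current (.inl (.Y i)) (.inr (.chi i)) j
  convert h using 1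
  · simp only [Generator.charge]
    split_ifs <;> simp
  · simp [Generator.pairing]

/-! ### The BRST charge -/

theorem HasOPE.nop_ghost_current {e : ZMod 2} {r : ℂ} {a : Fin (n - 1)} {j : Fin n}
    {A : FockField n} (hc : HasOPE 1 e (c a) A (r • one) 0) (hA : HasOPE 0 e (current j) A 0 0) :
    HasOPE 1 e (nop (c a) (current j)) A (r • current j) 0 := by
  have hρ := HasOPE.smul_one_left hc.residue_mem hA.left
  have h := hc.nop_left hA (r := 0) (by rwa [zero_smul])
  rw [nop_smul_one_left, zero_mul, koszulSign_zero, one_smul, mul_zero, add_zero] at h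
  simpa only [nop, prod_zero_right, zero_add] using h

theorem currentBRST_eq_sum :
    currentBRST n = ∑ a, nop (c a) (current (node a) - current (nodeSucc a)) := by
  refine Finset.sum_congr rfl fun a _ => congrArg _ ?_
  rw [current, current]
  abel

theorem Q_eq_prodₗ (A : FockField n) : Q A = prodₗ 0 (currentBRST n) A := rfl

theorem Q_eq_sum {e : ZMod 2} {r : Fin (n - 1) → ℂ} {A : FockField n}
    (hc : ∀ a, HasOPE 1 e (c a) A (r a • one) 0) (hA : ∀ j, HasOPE 0 e (current j) A 0 0) :
    Q A = ∑ a, r a • (current (node a) - current (nodeSucc a)) := by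
  rw [Q_eq_prodₗ, currentBRST_eq_sum, map_sum, LinearMap.sum_apply]
  refine Finset.sum_congr rfl fun a _ => ?_
  have hnop : nop (c a) (current (node a) - current (nodeSucc a)) =
      nop (c a) (current (node a)) - nop (c a) (current (nodeSucc a)) := map_sub (prodₗ (-1) _) _ _
  rw [hnop, map_sub, LinearMap.sub_apply, prodₗ_apply, prodₗ_apply,
    ((hc a).nop_ghost_current (hA _)).prod_zero, ((hc a).nop_ghost_current (hA _)).prod_zero,
    smul_sub]

theorem Q_eq_zero {e : ZMod 2} {A : FockField n} (hc : ∀ a, HasOPE 1 e (c a) A 0 0)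
    (hA : ∀ j, HasOPE 0 e (current j) A 0 0) : Q A = 0 := by
  simpa only [zero_smul, Finset.sum_const_zero] using
    Q_eq_sum (r := fun _ => 0) (fun a => by simpa only [zero_smul] using hc a) hA

theorem Q_b (a : Fin (n - 1)) :
    Q (b a : FockField n) = current (node a) - current (nodeSucc a) := by
  have h := Q_eq_sum (fun a' => (Generator.hasOPE (.inr (.c a')) (.inr (.b a))))
    fun j => by simpa only [Generator.charge, zero_smul] using
      current_hasOPE_field j (.inr (.b a))
  simpa [Generator.pairing, Fermion.dual, Generator.field, ite_smul] using h

theorem Generator.ghost_hasOPE_nop {s t : Generator n} (a : Fin (n - 1))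
    (hs : s.pairing (.inr (.c a)) = 0) (ht : t.pairing (.inr (.c a)) = 0) :
    HasOPE 1 (s.degree + t.degree) (c a) (nop s.field t.field) 0 0 := by
  have h : HasOPE 1 _ (c a) _ _ _ := (Generator.nop_hasOPE s t (.inr (.c a))).symm
  simpa only [hs, ht, mul_zero, zero_smul, add_zero, smul_zero] using h

theorem ghost_hasOPE_current (a : Fin (n - 1)) (i : Fin n) : HasOPE 1 0 (c a) (current i) 0 0 := by
  simpa [Generator.charge, Generator.degree, Generator.field] using
    (current_hasOPE_field i (.inr (.c a))).symm

theorem Q_current (i : Fin n) : Q (current i) = 0 :=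
  Q_eq_zero (fun a => ghost_hasOPE_current a i) fun j => current_hasOPE_current j i

theorem Q_Mplus (i : Fin n) : Q (Mplus i) = 0 :=
  Q_eq_zero (e := 1) (fun a => Generator.ghost_hasOPE_nop (s := .inl (.X i))
      (t := .inr (.psi i)) a (by simp [Generator.pairing])
      (by simp [Generator.pairing, Fermion.dual]))
    fun j => by simpa using (Mplus_hasOPE_current i j).symm

theorem Q_Mminus (i : Fin n) : Q (Mminus i) = 0 :=
  Q_eq_zero (e := 1) (fun a => Generator.ghost_hasOPE_nop (s := .inl (.Y i))
      (t := .inr (.chi i)) a (by simp [Generator.pairing])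
      (by simp [Generator.pairing, Fermion.dual]))
    fun j => by simpa using (Mminus_hasOPE_current i j).symm

theorem Q_one : Q (one : FockField n) = 0 := by
  have h {e : ZMod 2} {A : FockField n} (hA : A ∈ fieldsOfParity n e) : HasOPE e 0 A one 0 0 := by
    simpa using (HasOPE.smul_one_left (Submodule.smul_mem _ 1 one_mem_fieldsOfParity) hA).symm
  exact Q_eq_zero (fun a => h (ghost_hasOPE_current a (node a)).left)
    fun j => h (current_hasOPE_current j j).left

theorem currentBRST_mem_fieldsOfParity : currentBRST n ∈ fieldsOfParity n 1 := by
  rw [currentBRST_eq_sum]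
  have hcurrent (i : Fin n) : current i ∈ fieldsOfParity n 0 := (current_hasOPE_current i i).left
  exact sum_mem fun a _ => prod_mem_fieldsOfParity (ghost_hasOPE_current a (node a)).left
    (sub_mem (hcurrent _) (hcurrent _)) _

theorem Q_prod (A : FockField n) (p : ℤ) (B : FockField n) :
    Q (prod A p B) = prod (Q A) p B + prod (conj A) p (Q B) :=
  prod_zero_prod currentBRST_mem_fieldsOfParity A p B

theorem Q_prod_eq_zero {A B : FockField n} (hA : Q A = 0) (p : ℤ) (hB : Q B = 0) :
    Q (prod A p B) = 0 := by
  rw [Q_prod, hA, hB, prod_zero_right, ← prodₗ_apply, map_zero, LinearMap.zero_apply, add_zero]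

theorem Q_conj (A : FockField n) : Q (conj A) = -conj (Q A) := by
  rw [Q, Q, conj_prod, mem_fieldsOfParity.1 currentBRST_mem_fieldsOfParity, koszulSign_one,
    prod_smul_left]
  module

/-! ### BRST cohomology -/

theorem one_mem_generatedBy (S : Set (FockField n)) : one ∈ generatedBy S :=
  Submodule.mem_sInf.2 fun _ hM => hM.1

theorem subset_generatedBy (S : Set (FockField n)) : S ⊆ generatedBy S :=
  fun _ hA => Submodule.mem_sInf.2 fun _ hM => hM.2.1 hA

theorem prod_mem_generatedBy {S : Set (FockField n)} {A B : FockField n}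
    (hA : A ∈ generatedBy S) (p : ℤ) (hB : B ∈ generatedBy S) : prod A p B ∈ generatedBy S :=
  Submodule.mem_sInf.2 fun M hM => hM.2.2 A (Submodule.mem_sInf.1 hA M hM) B
    (Submodule.mem_sInf.1 hB M hM) p

theorem der_mem_generatedBy {S : Set (FockField n)} {A : FockField n}
    (hA : A ∈ generatedBy S) : der A ∈ generatedBy S := by
  rw [← prod_neg_two_one]
  exact prod_mem_generatedBy hA _ (one_mem_generatedBy S)

theorem generatedBy_le {S : Set (FockField n)} {M : Submodule ℂ (FockField n)} (hone : one ∈ M)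
    (hS : S ⊆ M) (hM : ∀ A ∈ M, ∀ B ∈ M, ∀ p : ℤ, prod A p B ∈ M) : generatedBy S ≤ M :=
  sInf_le ⟨hone, hS, hM⟩

theorem conj_mem_generatedBy {S : Set (FockField n)}
    (hS : ∀ A ∈ S, ∃ e, A ∈ fieldsOfParity n e) {A : FockField n} (hA : A ∈ generatedBy S) :
    conj A ∈ generatedBy S := by
  refine generatedBy_le (M := (generatedBy S).comap conj) ?_ (fun B hB => ?_)
    (fun B hB C hC p => ?_) hA
  · rw [Submodule.mem_comap, mem_fieldsOfParity.1 one_mem_fieldsOfParity]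
    exact Submodule.smul_mem _ _ (one_mem_generatedBy S)
  · obtain ⟨e, he⟩ := hS B hB
    rw [SetLike.mem_coe, Submodule.mem_comap, mem_fieldsOfParity.1 he]
    exact Submodule.smul_mem _ _ (subset_generatedBy S hB)
  · rw [Submodule.mem_comap, conj_prod]
    exact prod_mem_generatedBy hB p hC

theorem fullAlgebra_eq_generatedBy_range :
    fullAlgebra n = generatedBy (Set.range Generator.field) := by
  refine congrArg generatedBy (Set.ext fun A => ?_)
  constructor
  · rintro (((((⟨i, rfl⟩ | ⟨i, rfl⟩) | ⟨i, rfl⟩) | ⟨i, rfl⟩) | ⟨a, rfl⟩) | ⟨a, rfl⟩)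
    exacts [⟨.inl (.X i), rfl⟩, ⟨.inl (.Y i), rfl⟩, ⟨.inr (.psi i), rfl⟩, ⟨.inr (.chi i), rfl⟩,
      ⟨.inr (.b a), rfl⟩, ⟨.inr (.c a), rfl⟩]
  · rintro ⟨(i | i) | (i | i | a | a), rfl⟩ <;> simp [Generator.field]

theorem Generator.field_mem_fullAlgebra (s : Generator n) : s.field ∈ fullAlgebra n := by
  rw [fullAlgebra_eq_generatedBy_range]
  exact subset_generatedBy _ ⟨s, rfl⟩

theorem Generator.nop_mem_fullAlgebra (s t : Generator n) :
    nop s.field t.field ∈ fullAlgebra n :=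
  prod_mem_generatedBy s.field_mem_fullAlgebra _ t.field_mem_fullAlgebra

theorem conj_mem_fullAlgebra {A : FockField n} (hA : A ∈ fullAlgebra n) :
    conj A ∈ fullAlgebra n := by
  rw [fullAlgebra_eq_generatedBy_range] at *
  exact conj_mem_generatedBy (by rintro _ ⟨s, rfl⟩; exact ⟨s.degree, s.field_mem⟩) hA

/-- The BRST cocycles: the `Q`-closed fields of the full algebra. -/
def cocycles (n : ℕ) : Submodule ℂ (FockField n) :=
  LinearMap.ker (prodₗ 0 (currentBRST n)) ⊓ fullAlgebra n

/-- The BRST coboundaries: the image of `Q` on the full algebra. -/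
def coboundaries (n : ℕ) : Submodule ℂ (FockField n) :=
  (fullAlgebra n).map (prodₗ 0 (currentBRST n))

theorem mem_cocycles {A : FockField n} : A ∈ cocycles n ↔ Q A = 0 ∧ A ∈ fullAlgebra n := Iff.rfl

theorem mem_coboundaries {A : FockField n} :
    A ∈ coboundaries n ↔ ∃ C ∈ fullAlgebra n, Q C = A := Iff.rfl

theorem one_mem_cocycles : one ∈ cocycles n := ⟨Q_one, one_mem_generatedBy _⟩

theorem prod_mem_cocycles {A B : FockField n} (hA : A ∈ cocycles n) (p : ℤ)
    (hB : B ∈ cocycles n) : prod A p B ∈ cocycles n :=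
  ⟨Q_prod_eq_zero hA.1 p hB.1, prod_mem_generatedBy hA.2 p hB.2⟩

theorem generatedBy_le_cocycles {S : Set (FockField n)} (hS : S ⊆ cocycles n) :
    generatedBy S ≤ cocycles n :=
  generatedBy_le one_mem_cocycles hS fun _ hA _ hB p => prod_mem_cocycles hA p hB

theorem current_mem_cocycles (i : Fin n) : current i ∈ cocycles n :=
  ⟨Q_current i, add_mem (Generator.nop_mem_fullAlgebra (.inl (.X i)) (.inl (.Y i)))
    (Generator.nop_mem_fullAlgebra (.inr (.psi i)) (.inr (.chi i)))⟩

theorem Mplus_mem_cocycles (i : Fin n) : Mplus i ∈ cocycles n :=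
  ⟨Q_Mplus i, Generator.nop_mem_fullAlgebra (.inl (.X i)) (.inr (.psi i))⟩

theorem Mminus_mem_cocycles (i : Fin n) : Mminus i ∈ cocycles n :=
  ⟨Q_Mminus i, Generator.nop_mem_fullAlgebra (.inl (.Y i)) (.inr (.chi i))⟩

theorem prod_mem_coboundaries_of_right {A B : FockField n} (hA : A ∈ cocycles n) (p : ℤ)
    (hB : B ∈ coboundaries n) : prod A p B ∈ coboundaries n := by
  obtain ⟨C, hC, rfl⟩ := mem_coboundaries.1 hB
  refine ⟨prod (conj A) p C, prod_mem_generatedBy (conj_mem_fullAlgebra hA.2) p hC, ?_⟩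
  have hclosed : Q (conj A) = 0 := by rw [Q_conj, (mem_cocycles.1 hA).1, map_zero, neg_zero]
  rw [← Q_eq_prodₗ, Q_prod, hclosed, conj_conj, ← prodₗ_apply, map_zero, LinearMap.zero_apply,
    zero_add]

theorem prod_mem_coboundaries_of_left {A B : FockField n} (hA : A ∈ coboundaries n) (p : ℤ)
    (hB : B ∈ cocycles n) : prod A p B ∈ coboundaries n := by
  obtain ⟨C, hC, rfl⟩ := mem_coboundaries.1 hA
  refine ⟨prod C p B, prod_mem_generatedBy hC p hB.2, ?_⟩
  rw [← Q_eq_prodₗ, Q_prod, (mem_cocycles.1 hB).1, prod_zero_right, add_zero]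

theorem brstEquiv_iff {A B : FockField n} : BRSTEquiv A B ↔ A - B ∈ coboundaries n := by
  simp only [BRSTEquiv, mem_coboundaries, eq_comm]

namespace BRSTEquiv

variable {A A' B B' C : FockField n}

theorem refl (A : FockField n) : BRSTEquiv A A := by
  rw [brstEquiv_iff, sub_self]
  exact zero_mem _

theorem trans (h : BRSTEquiv A B) (h' : BRSTEquiv B C) : BRSTEquiv A C := by
  rw [brstEquiv_iff, ← sub_add_sub_cancel A B C]
  exact add_mem (brstEquiv_iff.1 h) (brstEquiv_iff.1 h')

theorem symm (h : BRSTEquiv A B) : BRSTEquiv B A := by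
  rw [brstEquiv_iff, ← neg_sub]
  exact neg_mem (brstEquiv_iff.1 h)

theorem add (h : BRSTEquiv A A') (h' : BRSTEquiv B B') : BRSTEquiv (A + B) (A' + B') := by
  rw [brstEquiv_iff, add_sub_add_comm]
  exact add_mem (brstEquiv_iff.1 h) (brstEquiv_iff.1 h')

theorem sub (h : BRSTEquiv A A') (h' : BRSTEquiv B B') : BRSTEquiv (A - B) (A' - B') := by
  rw [brstEquiv_iff, sub_sub_sub_comm]
  exact sub_mem (brstEquiv_iff.1 h) (brstEquiv_iff.1 h')

theorem smul (r : ℂ) (h : BRSTEquiv A A') : BRSTEquiv (r • A) (r • A') := by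
  have hr : r • A - r • A' = r • (A - A') := by module
  rw [brstEquiv_iff, hr]
  exact Submodule.smul_mem _ r (brstEquiv_iff.1 h)

theorem prod (hA : BRSTEquiv A A') (p : ℤ) (hB : BRSTEquiv B B') (memA : A ∈ cocycles n)
    (memB' : B' ∈ cocycles n) : BRSTEquiv (BoundaryVOA.prod A p B) (BoundaryVOA.prod A' p B') := by
  have hsplit : BoundaryVOA.prod A p B - BoundaryVOA.prod A' p B' =
      BoundaryVOA.prod A p (B - B') + BoundaryVOA.prod (A - A') p B' := by
    simp only [← prodₗ_apply, map_sub, LinearMap.sub_apply, sub_add_sub_cancel]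
  rw [brstEquiv_iff, hsplit]
  exact add_mem (prod_mem_coboundaries_of_right memA p (brstEquiv_iff.1 hB))
    (prod_mem_coboundaries_of_left (brstEquiv_iff.1 hA) p memB')

theorem nop (hA : BRSTEquiv A A') (hB : BRSTEquiv B B') (memA : A ∈ cocycles n)
    (memB' : B' ∈ cocycles n) : BRSTEquiv (BoundaryVOA.nop A B) (BoundaryVOA.nop A' B') :=
  hA.prod (-1) hB memA memB'

theorem der (h : BRSTEquiv A A') (hA : A ∈ cocycles n) :
    BRSTEquiv (BoundaryVOA.der A) (BoundaryVOA.der A') := by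
  rw [← prod_neg_two_one, ← prod_neg_two_one]
  exact h.prod (-2) (refl one) hA one_mem_cocycles

end BRSTEquiv

theorem exists_brstEquiv_of_mem_generatedBy {S S' : Set (FockField n)} (hS : S ⊆ cocycles n)
    (hS' : S' ⊆ cocycles n) (h : ∀ A ∈ S, ∃ B ∈ generatedBy S', BRSTEquiv A B) :
    ∀ A ∈ generatedBy S, ∃ B ∈ generatedBy S', BRSTEquiv A B := by
  have hmem {A : FockField n} :
      A ∈ generatedBy S' ⊔ coboundaries n ↔ ∃ B ∈ generatedBy S', BRSTEquiv A B := by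
    simp only [Submodule.mem_sup, brstEquiv_iff]
    refine exists_congr fun B => and_congr_right fun _ => ⟨?_, fun h => ⟨_, h, by abel⟩⟩
    rintro ⟨C, hC, rfl⟩
    rwa [add_sub_cancel_left]
  have hle : generatedBy S ≤ cocycles n ⊓ (generatedBy S' ⊔ coboundaries n) := by
    refine generatedBy_le ⟨one_mem_cocycles, Submodule.mem_sup_left (one_mem_generatedBy S')⟩
      (fun A hA => ⟨hS hA, hmem.2 (h A hA)⟩) ?_
    rintro A ⟨hA, hA'⟩ B ⟨hB, hB'⟩ p
    obtain ⟨A', memA', hAA'⟩ := hmem.1 hA'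
    obtain ⟨B', memB', hBB'⟩ := hmem.1 hB'
    exact ⟨prod_mem_cocycles hA p hB, hmem.2 ⟨_, prod_mem_generatedBy memA' p memB',
      hAA'.prod p hBB' hA (generatedBy_le_cocycles hS' memB')⟩⟩
  exact fun A hA => hmem.1 (hle hA).2

theorem current_node_equiv (a : Fin (n - 1)) :
    BRSTEquiv (current (node a)) (current (nodeSucc a)) :=
  ⟨b a, Generator.field_mem_fullAlgebra (.inr (.b a)), (Q_b a).symm⟩

theorem current_equiv_current (i j : Fin n) : BRSTEquiv (current i) (current j) := by
  have hzero (k : ℕ) (hk : k < n) : BRSTEquiv (current ⟨0, by omega⟩) (current ⟨k, hk⟩) := by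
    induction k with
    | zero => exact .refl _
    | succ k ih => exact (ih (by omega)).trans (current_node_equiv ⟨k, by omega⟩)
  exact (hzero i i.2).symm.trans (hzero j j.2)

theorem U_add_UF_eq : U n + UF n = (-(1 / (n : ℂ))) • ∑ i : Fin n, current i := by
  rw [U, UF, ← smul_add, ← Finset.sum_add_distrib]
  rfl

theorem U_add_UF_mem_cocycles : U n + UF n ∈ cocycles n := by
  rw [U_add_UF_eq]
  exact Submodule.smul_mem _ _ (sum_mem fun i _ => current_mem_cocycles i)

theorem neg_current_equiv (i : Fin n) : BRSTEquiv (-current i) (U n + UF n) := by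
  have hn : (n : ℂ) ≠ 0 := Nat.cast_ne_zero.2 i.pos.ne'
  have h : -current i - (U n + UF n) = (1 / (n : ℂ)) • ∑ j : Fin n, (current j - current i) := by
    rw [U_add_UF_eq, Finset.sum_sub_distrib, Finset.sum_const, Finset.card_univ, Fintype.card_fin,
      ← Nat.cast_smul_eq_nsmul ℂ]
    match_scalars <;> field_simp
  rw [brstEquiv_iff, h]
  exact Submodule.smul_mem _ _ (sum_mem fun j _ => brstEquiv_iff.1 (current_equiv_current j i))

/-! ### The normal ordering computation -/

/-- Operators that satisfy the commutation relations of the creation modes of `X_i`, `Y_i`, `ψ_i`,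
`χ_i` (with `x k` for `X_{i,(-k-1)}`, and so on) and of the modes of degree `-1` of `X_i Y_i`,
`ψ_i χ_i`, `X_i ψ_i`, `Y_i χ_i`, together with their values on a vacuum vector. -/
structure CreationRelations {V : Type*} [AddCommGroup V] [Module ℂ V]
    (x y f g : ℕ → Module.End ℂ V) (α β μ ν : Module.End ℂ V) (o : V) : Prop where
  x_x : ∀ k l B, x k (x l B) = x l (x k B)
  y_y : ∀ k l B, y k (y l B) = y l (y k B)
  f_f : ∀ k B, f k (f k B) = 0
  g_g : ∀ k B, g k (g k B) = 0
  y_x : ∀ k l B, y k (x l B) = x l (y k B)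
  f_x : ∀ k l B, f k (x l B) = x l (f k B)
  f_y : ∀ k l B, f k (y l B) = y l (f k B)
  g_x : ∀ k l B, g k (x l B) = x l (g k B)
  g_y : ∀ k l B, g k (y l B) = y l (g k B)
  g_f : ∀ k l B, g k (f l B) = -f l (g k B)
  α_x : ∀ k B, α (x k B) = x k (α B) - x (k + 1) B
  α_y : ∀ k B, α (y k B) = y k (α B) + y (k + 1) B
  α_f : ∀ k B, α (f k B) = f k (α B)
  α_g : ∀ k B, α (g k B) = g k (α B)
  β_x : ∀ k B, β (x k B) = x k (β B)
  β_y : ∀ k B, β (y k B) = y k (β B)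
  β_f : ∀ k B, β (f k B) = f k (β B) + f (k + 1) B
  β_g : ∀ k B, β (g k B) = g k (β B) - g (k + 1) B
  μ_y : ∀ k B, μ (y k B) = y k (μ B) + f (k + 1) B
  μ_g : ∀ k B, μ (g k B) = -g k (μ B) + x (k + 1) B
  ν_x : ∀ k B, ν (x k B) = x k (ν B) - g (k + 1) B
  ν_f : ∀ k B, ν (f k B) = -f k (ν B) + y (k + 1) B
  α_o : α o = x 0 (y 0 o)
  β_o : β o = f 0 (g 0 o)
  μ_o : μ o = x 0 (f 0 o)
  ν_o : ν o = y 0 (g 0 o)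

section

variable {V : Type*} [AddCommGroup V] [Module ℂ V] {x y f g : ℕ → Module.End ℂ V}
  {α β μ ν : Module.End ℂ V} {o : V}

theorem CreationRelations.quadratic (h : CreationRelations x y f g α β μ ν o) :
    (1 / 2 : ℂ) • ((-α (-α o) + x 0 (y 0 (-α o))) + -α (-α o)) =
      (1 / 2 : ℂ) • (α + β) ((α + β) o) - (1 / 2 : ℂ) • (μ (ν o) - ν (μ o)) := by
  simp only [h.g_g, h.y_x, h.f_x, h.f_y, h.g_x, h.g_y,
    h.g_f, h.α_x, h.α_y, h.α_f, h.α_g, h.β_x, h.β_y, h.β_f, h.β_g, h.μ_y, h.μ_g,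
    h.ν_x, h.ν_f, h.α_o, h.β_o, h.μ_o, h.ν_o, map_add, map_sub, map_neg,
    map_zero, LinearMap.add_apply, zero_add]
  module

theorem CreationRelations.cubic (h : CreationRelations x y f g α β μ ν o) :
    (-α (-α (-α o) + x 0 (y 0 (-α o))) + x 0 (y 0 (-α (-α o) + x 0 (y 0 (-α o))))) +
        (1 / 2 : ℂ) • (-α (-α (-α o)) + x 0 (y 0 (-α (-α o)))) +
        (1 / 2 : ℂ) • -α (-α (-α o) + x 0 (y 0 (-α o))) + -α (-α (-α o)) =
      (3 / 2 : ℂ) • (μ (y 1 (g 0 o) + y 0 (g 1 o)) + ν (x 1 (f 0 o) + x 0 (f 1 o))) +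
        (3 / 2 : ℂ) • (α + β) (μ (ν o) - ν (μ o)) - (α + β) ((α + β) ((α + β) o)) -
        (2 : ℂ) • (x 2 (y 0 o) + x 1 (y 1 o) + x 0 (y 2 o) +
          (f 2 (g 0 o) + f 1 (g 1 o) + f 0 (g 2 o))) := by
  simp only [h.x_x, h.y_y, h.f_f, h.g_g, h.y_x, h.f_x, h.f_y, h.g_x, h.g_y,
    h.g_f, h.α_x, h.α_y, h.α_f, h.α_g, h.β_x, h.β_y, h.β_f, h.β_g, h.μ_y, h.μ_g,
    h.ν_x, h.ν_f, h.α_o, h.β_o, h.μ_o, h.ν_o, map_add, map_sub, map_neg,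
    map_zero, LinearMap.add_apply, zero_add, Nat.reduceAdd]
  module

end

theorem Generator.prodₗ_prodₗ (s t : Generator n) (k l : ℕ) (B : FockField n) :
    prodₗ (-1 - k) s.field (prodₗ (-1 - l) t.field B) =
      koszulSign (s.degree * t.degree) • prodₗ (-1 - l) t.field (prodₗ (-1 - k) s.field B) := by
  have h := (s.hasOPE t).prod_prod (-1 - k) (-1 - l) B
  rwa [prod_smul_left, prod_one_of_lt (by omega), smul_zero, add_zero] at h

theorem Generator.prodₗ_nop_prodₗ (s t u : Generator n) (k : ℕ) (B : FockField n) :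
    prodₗ (-1) (nop s.field t.field) (prodₗ (-1 - k) u.field B) =
      koszulSign ((s.degree + t.degree) * u.degree) •
          prodₗ (-1 - k) u.field (prodₗ (-1) (nop s.field t.field) B) +
        (t.pairing u • prodₗ (-1 - ↑(k + 1)) s.field B +
          (koszulSign (t.degree * u.degree) * s.pairing u) •
            prodₗ (-1 - ↑(k + 1)) t.field B) := by
  have h := (Generator.nop_hasOPE s t u).prod_prod (-1) (-1 - k) B
  rw [show (-1 : ℤ) + (-1 - k) = -1 - ↑(k + 1) by push_cast; ring] at h
  simpa only [← prodₗ_apply, map_add, map_smul, LinearMap.add_apply, LinearMap.smul_apply] using h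

theorem Generator.prodₗ_prodₗ_self {s : Generator n} (hs : s.degree = 1) (k : ℕ)
    (B : FockField n) : prodₗ (-1 - k) s.field (prodₗ (-1 - k) s.field B) = 0 := by
  have h := s.prodₗ_prodₗ s k k B
  rw [hs, mul_one, koszulSign_one] at h
  have htwo : (2 : ℂ) • prodₗ (-1 - k) s.field (prodₗ (-1 - k) s.field B) = 0 := by
    nth_rewrite 1 [two_smul, h]
    module
  exact (smul_eq_zero.1 htwo).resolve_left two_ne_zero

open Generator in
theorem creationRelations (i : Fin n) :
    CreationRelations (fun k : ℕ => prodₗ (-1 - k) (X i)) (fun k : ℕ => prodₗ (-1 - k) (Y i))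
      (fun k : ℕ => prodₗ (-1 - k) (psi i)) (fun k : ℕ => prodₗ (-1 - k) (chi i))
      (prodₗ (-1) (nop (X i) (Y i))) (prodₗ (-1) (nop (psi i) (chi i))) (prodₗ (-1) (Mplus i))
      (prodₗ (-1) (Mminus i)) one := by
  have hneg (A : FockField n) : (-1 : ℂ) • A = -A := by module
  have hone (A B : FockField n) :
      prodₗ (-1) (nop A B) one = prodₗ (-1 - (0 : ℕ)) A (prodₗ (-1 - (0 : ℕ)) B one) := by
    simp only [prodₗ_apply, prod_neg_one_one, Nat.cast_zero, sub_zero, nop]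
  refine {
    x_x := fun k l B => (prodₗ_prodₗ (.inl (.X i)) (.inl (.X i)) k l B).trans ?_
    y_y := fun k l B => (prodₗ_prodₗ (.inl (.Y i)) (.inl (.Y i)) k l B).trans ?_
    f_f := prodₗ_prodₗ_self (s := .inr (.psi i)) rfl
    g_g := prodₗ_prodₗ_self (s := .inr (.chi i)) rfl
    y_x := fun k l B => (prodₗ_prodₗ (.inl (.Y i)) (.inl (.X i)) k l B).trans ?_
    f_x := fun k l B => (prodₗ_prodₗ (.inr (.psi i)) (.inl (.X i)) k l B).trans ?_
    f_y := fun k l B => (prodₗ_prodₗ (.inr (.psi i)) (.inl (.Y i)) k l B).trans ?_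
    g_x := fun k l B => (prodₗ_prodₗ (.inr (.chi i)) (.inl (.X i)) k l B).trans ?_
    g_y := fun k l B => (prodₗ_prodₗ (.inr (.chi i)) (.inl (.Y i)) k l B).trans ?_
    g_f := fun k l B => (prodₗ_prodₗ (.inr (.chi i)) (.inr (.psi i)) k l B).trans ?_
    α_x := fun k B => (prodₗ_nop_prodₗ (.inl (.X i)) (.inl (.Y i)) (.inl (.X i)) k B).trans ?_
    α_y := fun k B => (prodₗ_nop_prodₗ (.inl (.X i)) (.inl (.Y i)) (.inl (.Y i)) k B).trans ?_
    α_f := fun k B => (prodₗ_nop_prodₗ (.inl (.X i)) (.inl (.Y i)) (.inr (.psi i)) k B).trans ?_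
    α_g := fun k B => (prodₗ_nop_prodₗ (.inl (.X i)) (.inl (.Y i)) (.inr (.chi i)) k B).trans ?_
    β_x := fun k B => (prodₗ_nop_prodₗ (.inr (.psi i)) (.inr (.chi i)) (.inl (.X i)) k B).trans ?_
    β_y := fun k B => (prodₗ_nop_prodₗ (.inr (.psi i)) (.inr (.chi i)) (.inl (.Y i)) k B).trans ?_
    β_f := fun k B => (prodₗ_nop_prodₗ (.inr (.psi i)) (.inr (.chi i)) (.inr (.psi i)) k B).trans ?_
    β_g := fun k B => (prodₗ_nop_prodₗ (.inr (.psi i)) (.inr (.chi i)) (.inr (.chi i)) k B).trans ?_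
    μ_y := fun k B => (prodₗ_nop_prodₗ (.inl (.X i)) (.inr (.psi i)) (.inl (.Y i)) k B).trans ?_
    μ_g := fun k B => (prodₗ_nop_prodₗ (.inl (.X i)) (.inr (.psi i)) (.inr (.chi i)) k B).trans ?_
    ν_x := fun k B => (prodₗ_nop_prodₗ (.inl (.Y i)) (.inr (.chi i)) (.inl (.X i)) k B).trans ?_
    ν_f := fun k B => (prodₗ_nop_prodₗ (.inl (.Y i)) (.inr (.chi i)) (.inr (.psi i)) k B).trans ?_
    α_o := hone _ _
    β_o := hone _ _
    μ_o := hone _ _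
    ν_o := hone _ _ } <;>
    simp [hneg, field, degree, pairing, Boson.dual, Boson.sign, Fermion.dual, Mplus, Mminus,
      koszulSign_zero, koszulSign_one, sub_eq_add_neg, CharTwo.add_self_eq_zero]

/-! ### The exact forms of `T_i` and `W_i` -/

/-- The expression for `T_i` in a field `N` and a pair of fields `P`, `M`; the theorem has
`N = U + U_F`, `P = M_i^+` and `M = M_i^-`. -/
def quadraticForm (N P M : FockField n) : FockField n :=
  (1 / 2 : ℂ) • nop N N - (1 / 2 : ℂ) • nopComm P M

/-- The expression for `W_i` in a field `N` and a pair of fields `P`, `M`; the theorem has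
`N = U + U_F`, `P = M_i^+` and `M = M_i^-`. -/
def cubicForm (N P M : FockField n) : FockField n :=
  ((1 / 3 : ℂ) * (Real.sqrt (2 / 3) : ℂ)) •
    ((3 / 2 : ℂ) • (nop P (der M) + nop M (der P)) - (3 / 2 : ℂ) • nop N (nopComm P M) +
      nop N (nop N N) + der (der N))

theorem nop_eq_prodₗ (A B : FockField n) : nop A B = prodₗ (-1) A B := rfl

theorem prodₗ_neg_one_one (A : FockField n) : prodₗ (-1) A one = A := prod_neg_one_one A

theorem nopComm_eq_prodₗ (A B : FockField n) :
    nopComm A B = prodₗ (-1) A (prodₗ (-1) B one) - prodₗ (-1) B (prodₗ (-1) A one) := by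
  simp only [nopComm, nop_eq_prodₗ, prodₗ_neg_one_one]

theorem der_eq_prodₗ (A : FockField n) : der A = prodₗ (-2) A one := (prod_neg_two_one A).symm

theorem der_add (A B : FockField n) : der (A + B) = der A + der B := by
  simp only [der_eq_prodₗ, map_add, LinearMap.add_apply]

theorem der_neg (A : FockField n) : der (-A) = -der A := by
  simp only [der_eq_prodₗ, map_neg, LinearMap.neg_apply]

theorem der_prodₗ (p : ℤ) (A B : FockField n) :
    der (prodₗ p A B) = (-(p : ℂ)) • prodₗ (p - 1) A B + prodₗ p A (der B) :=
  der_prod A p B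

theorem der_nop (A B : FockField n) :
    der (nop A B) = prodₗ (-2) A (prodₗ (-1) B one) + prodₗ (-1) A (prodₗ (-2) B one) := by
  rw [nop_eq_prodₗ, der_prodₗ, prodₗ_neg_one_one, der_eq_prodₗ B]
  norm_num

theorem der_der_nop (A B : FockField n) : der (der (nop A B)) =
    (2 : ℂ) • (prodₗ (-3) A (prodₗ (-1) B one) + prodₗ (-2) A (prodₗ (-2) B one) +
      prodₗ (-1) A (prodₗ (-3) B one)) := by
  have hB : der (prodₗ (-2) B one) = (2 : ℂ) • prodₗ (-3) B one := by
    rw [der_prodₗ, der_one, map_zero, add_zero]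
    norm_num
  rw [der_nop, der_add, der_prodₗ (-2) A, der_prodₗ (-1) A, hB, prodₗ_neg_one_one, der_eq_prodₗ B,
    map_smul]
  norm_num
  module

theorem prodₗ_current (i : Fin n) :
    prodₗ (-1) (current i) = prodₗ (-1) (nop (X i) (Y i)) + prodₗ (-1) (nop (psi i) (chi i)) :=
  map_add _ _ _

theorem current_eq (i : Fin n) : current i =
    (prodₗ (-1) (nop (X i) (Y i)) + prodₗ (-1) (nop (psi i) (chi i))) one := by
  rw [← prodₗ_current, prodₗ_neg_one_one]

theorem der_der_current (i : Fin n) : der (der (current i)) =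
    (2 : ℂ) • ((prodₗ (-3) (X i) (prodₗ (-1) (Y i) one) + prodₗ (-2) (X i) (prodₗ (-2) (Y i) one) +
        prodₗ (-1) (X i) (prodₗ (-3) (Y i) one)) +
      (prodₗ (-3) (psi i) (prodₗ (-1) (chi i) one) +
        prodₗ (-2) (psi i) (prodₗ (-2) (chi i) one) +
        prodₗ (-1) (psi i) (prodₗ (-3) (chi i) one))) := by
  rw [current, der_add, der_add, der_der_nop, der_der_nop, ← smul_add]

theorem calA_eq (i : Fin n) : calA i = -prodₗ (-1) (nop (X i) (Y i)) one := by
  rw [calA, prodₗ_neg_one_one]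

theorem hatA_eq (i : Fin n) (O : FockField n) :
    hatA i O = -prodₗ (-1) (nop (X i) (Y i)) O := by
  rw [hatA, calA, nop_eq_prodₗ, map_neg, LinearMap.neg_apply]

theorem calD_eq (i : Fin n) (O : FockField n) : calD i O =
    -prodₗ (-1) (nop (X i) (Y i)) O + prodₗ (-1) (X i) (prodₗ (-1) (Y i) O) := by
  rw [← hatA_eq, ← nop_eq_prodₗ, ← nop_eq_prodₗ, hatA, calD]

theorem T_eq_quadraticForm (i : Fin n) :
    T i = quadraticForm (-current i) (Mplus i) (Mminus i) := by
  have h := (creationRelations i).quadratic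
  simp only [Nat.cast_zero, sub_zero] at h
  rw [T, calD_eq, hatA_eq, calA_eq, h, quadraticForm, nopComm_eq_prodₗ, ← current_eq,
    ← prodₗ_current, nop_eq_prodₗ, map_neg, map_neg, LinearMap.neg_apply, neg_neg]

theorem W_eq_cubicForm (i : Fin n) : W i = cubicForm (-current i) (Mplus i) (Mminus i) := by
  have h := (creationRelations i).cubic
  simp only [Nat.cast_zero, sub_zero, Nat.cast_one, Nat.cast_ofNat] at h
  norm_num only at h
  have hMminus := der_nop (Y i) (chi i)
  have hMplus := der_nop (X i) (psi i)
  rw [← Mminus] at hMminus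
  rw [← Mplus] at hMplus
  rw [W, calD_eq, calD_eq, calD_eq, hatA_eq, hatA_eq, hatA_eq, calA_eq, h, ← current_eq,
    ← prodₗ_current, ← der_der_current, ← hMminus, ← hMplus, ← nopComm_eq_prodₗ, cubicForm]
  simp only [nop_eq_prodₗ, map_neg, LinearMap.neg_apply, der_neg, neg_neg]
  module

section

variable {S : Set (FockField n)} {N N' P M : FockField n}

theorem nopComm_mem_generatedBy (hP : P ∈ generatedBy S) (hM : M ∈ generatedBy S) :
    nopComm P M ∈ generatedBy S :=
  sub_mem (prod_mem_generatedBy hP _ hM) (prod_mem_generatedBy hM _ hP)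

theorem quadraticForm_mem_generatedBy (hN : N ∈ generatedBy S) (hP : P ∈ generatedBy S)
    (hM : M ∈ generatedBy S) : quadraticForm N P M ∈ generatedBy S :=
  sub_mem (Submodule.smul_mem _ _ (prod_mem_generatedBy hN _ hN))
    (Submodule.smul_mem _ _ (nopComm_mem_generatedBy hP hM))

theorem cubicForm_mem_generatedBy (hN : N ∈ generatedBy S) (hP : P ∈ generatedBy S)
    (hM : M ∈ generatedBy S) : cubicForm N P M ∈ generatedBy S := by
  have hder := add_mem (prod_mem_generatedBy hP (-1) (der_mem_generatedBy hM))
    (prod_mem_generatedBy hM (-1) (der_mem_generatedBy hP))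
  have hcomm := prod_mem_generatedBy hN (-1) (nopComm_mem_generatedBy hP hM)
  have hcube := prod_mem_generatedBy hN (-1) (prod_mem_generatedBy hN (-1) hN)
  exact Submodule.smul_mem _ _ (add_mem (add_mem (sub_mem (Submodule.smul_mem _ _ hder)
    (Submodule.smul_mem _ _ hcomm)) hcube) (der_mem_generatedBy (der_mem_generatedBy hN)))

theorem BRSTEquiv.quadraticForm (h : BRSTEquiv N N') (hN : N ∈ cocycles n)
    (hN' : N' ∈ cocycles n) :
    BRSTEquiv (BoundaryVOA.quadraticForm N P M) (BoundaryVOA.quadraticForm N' P M) :=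
  ((h.nop h hN hN').smul _).sub (.refl _)

theorem BRSTEquiv.cubicForm (h : BRSTEquiv N N') (hN : N ∈ cocycles n) (hN' : N' ∈ cocycles n)
    (hP : P ∈ cocycles n) (hM : M ∈ cocycles n) :
    BRSTEquiv (BoundaryVOA.cubicForm N P M) (BoundaryVOA.cubicForm N' P M) := by
  have hcomm : nopComm P M ∈ cocycles n :=
    sub_mem (prod_mem_cocycles hP _ hM) (prod_mem_cocycles hM _ hP)
  have hder : BoundaryVOA.der N ∈ cocycles n := by
    rw [← prod_neg_two_one]
    exact prod_mem_cocycles hN _ one_mem_cocycles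
  exact .smul _ ((((BRSTEquiv.refl _).sub ((h.nop (.refl _) hN hcomm).smul _)).add
    (h.nop (h.nop h hN hN') hN (prod_mem_cocycles hN' _ hN'))).add ((h.der hN).der hder))

end

theorem T_equiv (i : Fin n) :
    BRSTEquiv (T i) (quadraticForm (U n + UF n) (Mplus i) (Mminus i)) := by
  rw [T_eq_quadraticForm]
  exact (neg_current_equiv i).quadraticForm (neg_mem (current_mem_cocycles i)) U_add_UF_mem_cocycles

theorem W_equiv (i : Fin n) : BRSTEquiv (W i) (cubicForm (U n + UF n) (Mplus i) (Mminus i)) := by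
  rw [W_eq_cubicForm]
  exact (neg_current_equiv i).cubicForm (neg_mem (current_mem_cocycles i)) U_add_UF_mem_cocycles
    (Mplus_mem_cocycles i) (Mminus_mem_cocycles i)

theorem subset_cocycles {N : FockField n} (hN : N ∈ cocycles n) (i : Fin n) :
    {N, Mplus i, Mminus i} ⊆ (cocycles n : Set (FockField n)) := by
  rintro A (rfl | rfl | rfl)
  exacts [hN, Mplus_mem_cocycles i, Mminus_mem_cocycles i]

theorem T_W_subset_cocycles (i : Fin n) : {T i, W i} ⊆ (cocycles n : Set (FockField n)) := by
  have hle := generatedBy_le_cocycles (subset_cocycles (neg_mem (current_mem_cocycles i)) i)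
  rintro A (rfl | rfl)
  · rw [T_eq_quadraticForm]
    exact hle (quadraticForm_mem_generatedBy (subset_generatedBy _ (by simp))
      (subset_generatedBy _ (by simp)) (subset_generatedBy _ (by simp)))
  · rw [W_eq_cubicForm]
    exact hle (cubicForm_mem_generatedBy (subset_generatedBy _ (by simp))
      (subset_generatedBy _ (by simp)) (subset_generatedBy _ (by simp)))

theorem exists_brstEquiv_of_mem_generatedBy_T_W (i : Fin n) :
    ∀ A ∈ generatedBy {T i, W i},
      ∃ B ∈ generatedBy {U n + UF n, Mplus i, Mminus i}, BRSTEquiv A B := by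
  have hN : U n + UF n ∈ generatedBy {U n + UF n, Mplus i, Mminus i} :=
    subset_generatedBy _ (by simp)
  have hP : Mplus i ∈ generatedBy {U n + UF n, Mplus i, Mminus i} :=
    subset_generatedBy _ (by simp)
  have hM : Mminus i ∈ generatedBy {U n + UF n, Mplus i, Mminus i} :=
    subset_generatedBy _ (by simp)
  refine exists_brstEquiv_of_mem_generatedBy (T_W_subset_cocycles i)
    (subset_cocycles U_add_UF_mem_cocycles i) ?_
  rintro A (rfl | rfl)
  exacts [⟨_, quadraticForm_mem_generatedBy hN hP hM, T_equiv i⟩,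
    ⟨_, cubicForm_mem_generatedBy hN hP hM, W_equiv i⟩]

end BoundaryVOA

end

theorem mainTheorem8 (n : ℕ) (i : Fin n) :
    BRSTEquiv (W i)
      (((1 / 3 : ℂ) * (Real.sqrt (2 / 3) : ℂ)) •
        ((3 / 2 : ℂ) • (nop (Mplus i) (der (Mminus i)) + nop (Mminus i) (der (Mplus i))) -
          (3 / 2 : ℂ) • nop (U n + UF n) (nopComm (Mplus i) (Mminus i)) +
          nop (U n + UF n) (nop (U n + UF n) (U n + UF n)) +
          der (der (U n + UF n)))) ∧
    BRSTEquiv (T i)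
      ((1 / 2 : ℂ) • nop (U n + UF n) (U n + UF n) -
        (1 / 2 : ℂ) • nopComm (Mplus i) (Mminus i)) ∧
    ∀ A ∈ generatedBy {T i, W i}, Q A = 0 ∧
      ∃ B ∈ generatedBy {U n + UF n, Mplus i, Mminus i}, Q B = 0 ∧ BRSTEquiv A B := by
  refine ⟨BoundaryVOA.W_equiv i, BoundaryVOA.T_equiv i, fun A hA => ?_⟩
  obtain ⟨B, hB, hAB⟩ := BoundaryVOA.exists_brstEquiv_of_mem_generatedBy_T_W i A hA
  have hA' := BoundaryVOA.generatedBy_le_cocycles (BoundaryVOA.T_W_subset_cocycles i) hA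
  have hB' := BoundaryVOA.generatedBy_le_cocycles
    (BoundaryVOA.subset_cocycles BoundaryVOA.U_add_UF_mem_cocycles i) hB
  exact ⟨hA'.1, B, hB, hB'.1, hAB⟩
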